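/- Let $p$ be a prime, let $K\subseteq L$ be finite extensions of $\mathbb{Q}_p$ with rings of integers $A\subseteq B$, and suppose that $L/K$ is unramified of degree $f$. Let $\pi$ be a uniformizer of $A$; it is then also a uniformizer of $B$. For $R\in\{A,B\}$ let $q_R$ denote the cardinality of the residue field of $R$. A formal $R$-module over an $R$-algebra $S$ is a commutative one-dimensional formal group law $F$ over $S$ with a ring homomorphism $R\to\operatorname{End}(F)$, $a\mapsto [a](X)$, such that $[a](X)\equiv aX \bmod X^2$. It is called $R$-typical if it is the pushforward of a formal $R$-module over a torsion-free $R$-algebra whose logarithm has the form $\sum_{n\ge 0}\ell_n X^{q_R^n}$ (for torsion-free $S$ this says that the logarithm of $F$ itself has this form). Let $V^R$ be the classifying ring of $R$-typical formal $R$-modules, that is, the $R$-algebra carrying the universal $R$-typical formal $R$-module $F^R$; this ring exists. Write the logarithm of $F^R$ as $\sum_{n\ge 0}\ell_n^R X^{q_R^n}$ with $\ell^R_n\in\mathbb{Q}\otimes_{\mathbb{Z}} V^R$. The Hazewinkel generators of $V^R$ with respect to $\pi$ are the unique elements $v_0^R,v_1^R,v_2^R,\dots$ of $V^R$ with $v_0^R=\pi$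 and $$\pi\,\ell_n^R=\sum_{i=0}^{n-1}\ell_i^R\,(v_{n-i}^R)^{q_R^i}\qquad (n\ge 1).$$ Let $\gamma\colon V^A\to V^B$ be the homomorphism of $A$-algebras classifying the $A$-typical formal $A$-module underlying $F^B$. Then, with the Hazewinkel generators of both $V^A$ and $V^B$ taken with respect to the same uniformizer $\pi$, the map $\gamma$ is determined (as a homomorphism of $A$-algebras) by $$\gamma(v_i^A)=\begin{cases} v_{i/f}^B & \text{if } f\mid i,\\ 0 & \text{if } f\nmid i,\end{cases}\qquad i\ge 0.$$ Consequently the map $\gamma^\sharp\colon V^A\otimes_A B\to V^B$, $x\otimes b\mapsto \gamma(x)b$, induces an isomorphism $$(V^A\otimes_A B)/(v_i^A : f\nmid i)\;\xrightarrow{\ \cong\ }\; V^B .$$ -/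

import Mathlib

open scoped TensorProduct

universe u

noncomputable section

/-! ### Rings of integers of `p`-adic number fields -/

section PadicNumberField

variable (p : ℕ) [Fact p.Prime] (K L : Type*) [Field K] [Field L]
  [Algebra ℚ_[p] K] [Algebra ℚ_[p] L]

/-- An extension of `ℚ_[p]` is an algebra over `ℤ_[p]`, by restriction of scalars. -/
instance padicIntAlgebra : Algebra ℤ_[p] K :=
  inferInstanceAs (Algebra (PadicInt.subring p) K)

instance padicIntScalarTower : IsScalarTower ℤ_[p] ℚ_[p] K :=
  inferInstanceAs (IsScalarTower (PadicInt.subring p) ℚ_[p] K)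

instance padicIntScalarTowerField [Algebra K L] [IsScalarTower ℚ_[p] K L] :
    IsScalarTower ℤ_[p] K L :=
  IsScalarTower.of_algebraMap_eq fun x => by
    rw [IsScalarTower.algebraMap_apply ℤ_[p] ℚ_[p] L, IsScalarTower.algebraMap_apply ℤ_[p] ℚ_[p] K,
      ← IsScalarTower.algebraMap_apply ℚ_[p] K L]

/-- The ring of integers of an extension `K` of `ℚ_[p]`: the integral closure of `ℤ_[p]` in `K`. -/
abbrev padicRingOfIntegers : Subalgebra ℤ_[p] K := integralClosure ℤ_[p] K

variable {p K} in
/-- The integers of `K` are the elements of (spectral) norm at most one. -/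
theorem mem_padicRingOfIntegers_iff [Algebra.IsAlgebraic ℚ_[p] K] (x : K) :
    x ∈ padicRingOfIntegers p K ↔ spectralNorm ℚ_[p] K x ≤ 1 := by
  have hx : IsIntegral ℚ_[p] x := Algebra.IsIntegral.isIntegral x
  rw [mem_integralClosure_iff, spectralNorm, spectralValue_le_one_iff (minpoly.monic hx)]
  constructor
  · intro h n
    rw [minpoly.isIntegrallyClosed_eq_field_fractions' ℚ_[p] h, Polynomial.coeff_map]
    exact ((minpoly ℤ_[p] x).coeff n).2
  · intro h
    have hlift : minpoly ℚ_[p] x ∈ Polynomial.lifts (algebraMap ℤ_[p] ℚ_[p]) := by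
      rw [Polynomial.lifts_iff_coeff_lifts]
      exact fun n => ⟨⟨_, h n⟩, rfl⟩
    obtain ⟨q, hq, -, hqm⟩ := Polynomial.lifts_and_degree_eq_and_monic hlift (minpoly.monic hx)
    refine ⟨q, hqm, ?_⟩
    have := minpoly.aeval ℚ_[p] x
    rwa [← hq, Polynomial.aeval_map_algebraMap] at this

/-- The ring of integers of a `p`-adic number field is a local ring. -/
instance padicRingOfIntegers_isLocalRing [Algebra.IsAlgebraic ℚ_[p] K] :
    IsLocalRing (padicRingOfIntegers p K) := by
  have key : ∀ a : padicRingOfIntegers p K,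
      a ∈ nonunits (padicRingOfIntegers p K) ↔ spectralNorm ℚ_[p] K a < 1 := by
    intro a
    have hmul := fun x y : K => map_mul (spectralMulAlgNorm ℚ_[p] K) x y
    simp only [spectralMulAlgNorm_def] at hmul
    rw [mem_nonunits_iff, ← not_le, not_iff_not]
    constructor
    · rintro ⟨v, rfl⟩
      by_contra! hlt
      have h1 := hmul ((v : padicRingOfIntegers p K) : K)
        (((v⁻¹ : (padicRingOfIntegers p K)ˣ) : padicRingOfIntegers p K) : K)
      have h2 : ((v : padicRingOfIntegers p K) : K) *
          (((v⁻¹ : (padicRingOfIntegers p K)ˣ) : padicRingOfIntegers p K) : K) = 1 := by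
        rw [← Subalgebra.coe_mul, Units.mul_inv, Subalgebra.coe_one]
      rw [h2, spectralNorm_one] at h1
      have h3 := (mem_padicRingOfIntegers_iff _).1
        ((v⁻¹ : (padicRingOfIntegers p K)ˣ) : padicRingOfIntegers p K).2
      have h4 := spectralNorm_nonneg (K := ℚ_[p]) ((v : padicRingOfIntegers p K) : K)
      nlinarith
    · intro h
      have ha0 : (a : K) ≠ 0 := by
        intro h0
        rw [h0, spectralNorm_zero] at h
        linarith
      have h1 := hmul (a : K) (a : K)⁻¹
      rw [mul_inv_cancel₀ ha0, spectralNorm_one] at h1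
      have hinv : (a : K)⁻¹ ∈ padicRingOfIntegers p K := by
        rw [mem_padicRingOfIntegers_iff]
        have h4 := spectralNorm_nonneg (K := ℚ_[p]) (a : K)⁻¹
        nlinarith
      exact IsUnit.of_mul_eq_one ⟨(a : K)⁻¹, hinv⟩ (Subtype.ext (mul_inv_cancel₀ ha0))
  refine IsLocalRing.of_nonunits_add fun a b ha hb => ?_
  rw [key] at ha hb ⊢
  exact lt_of_le_of_lt (isNonarchimedean_spectralNorm (a : K) (b : K)) (max_lt ha hb)

/-- For an extension `L/K`, the ring of integers of `L` is an algebra over that of `K`. -/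
instance padicRingOfIntegersAlgebra [Algebra K L] [IsScalarTower ℚ_[p] K L] :
    Algebra (padicRingOfIntegers p K) (padicRingOfIntegers p L) :=
  RingHom.toAlgebra
    { toFun := fun x => ⟨algebraMap K L x, IsIntegral.algebraMap x.2⟩
      map_one' := Subtype.ext (map_one _)
      map_zero' := Subtype.ext (map_zero _)
      map_mul' := fun _ _ => Subtype.ext (map_mul _ _ _)
      map_add' := fun _ _ => Subtype.ext (map_add _ _ _) }

end PadicNumberField

/-! ### Formal modules -/

/-- A (one-dimensional) formal `A`-module over the `A`-algebra `R`: a commutative formal group law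
`F` over `R` together with a ring homomorphism `ρ : A → End(F)`, `a ↦ [a](X)`, such that
`[a](X) ≡ aX mod X²`. The last five fields say that each `[a]` is an endomorphism of `F`,
and that `a ↦ [a]` is compatible with the ring structure of `End(F)`, in which addition
is `φ +_F ψ = F(φ, ψ)`, multiplication is composition, and the unit is `X`. -/
structure FormalModule (A R : Type*) [CommRing A] [CommRing R] [Algebra A R] where
  /-- the underlying formal group law -/
  law : FormalGroup R
  law_comm : law.IsComm
  /-- the power series `[a](X)` -/
  act : A → PowerSeries R
  act_constantCoeff : ∀ a, PowerSeries.constantCoeff (act a) = 0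
  act_coeff_one : ∀ a, PowerSeries.coeff 1 (act a) = algebraMap A R a
  act_hom : ∀ a, PowerSeries.subst law.toPowerSeries (act a) =
    MvPowerSeries.subst ![PowerSeries.subst (MvPowerSeries.X 0 : MvPowerSeries (Fin 2) R) (act a),
      PowerSeries.subst (MvPowerSeries.X 1 : MvPowerSeries (Fin 2) R) (act a)] law.toPowerSeries
  act_add : ∀ a b, act (a + b) =
    (MvPowerSeries.subst ![act a, act b] law.toPowerSeries : PowerSeries R)
  act_mul : ∀ a b, act (a * b) = PowerSeries.subst (act b) (act a)
  act_one : act 1 = PowerSeries.X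

namespace FormalModule

variable {A B R S : Type*} [CommRing A] [CommRing B] [CommRing R] [CommRing S]
  [Algebra A R] [Algebra A S]

@[ext]
theorem ext {F G : FormalModule A R} (h₁ : F.law = G.law) (h₂ : F.act = G.act) : F = G := by
  cases F
  cases G
  cases h₁
  cases h₂
  rfl

/-- The pushforward of a formal `A`-module along a homomorphism of `A`-algebras: apply the
homomorphism to all the coefficients. -/
def map (F : FormalModule A R) (φ : R →ₐ[A] S) : FormalModule A S where
  law := F.law.map (φ : R →+* S)
  law_comm := ⟨by
    have h := F.law_comm.comm
    have h' := congrArg (MvPowerSeries.map (φ : R →+* S)) h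
    rw [MvPowerSeries.map_subst MvPowerSeries.HasSubst.X_X] at h'
    refine h'.trans ?_
    congr 1
    funext i
    fin_cases i <;> simp⟩
  act a := PowerSeries.map (φ : R →+* S) (F.act a)
  act_constantCoeff a := by
    rw [← PowerSeries.coeff_zero_eq_constantCoeff_apply, PowerSeries.coeff_map,
      PowerSeries.coeff_zero_eq_constantCoeff_apply, F.act_constantCoeff, map_zero]
  act_coeff_one a := by
    rw [PowerSeries.coeff_map, F.act_coeff_one]
    exact φ.commutes a
  act_hom a := by
    have hc (i : Fin 2) : PowerSeries.HasSubst (MvPowerSeries.X i : MvPowerSeries (Fin 2) R) :=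
      PowerSeries.HasSubst.X i
    have hz (i : Fin 2) : MvPowerSeries.constantCoeff
        (PowerSeries.subst (MvPowerSeries.X i : MvPowerSeries (Fin 2) R) (F.act a)) = 0 :=
      PowerSeries.constantCoeff_subst_eq_zero (by simp) _ (F.act_constantCoeff a)
    have h' := congrArg (MvPowerSeries.map (φ : R →+* S)) (F.act_hom a)
    rw [PowerSeries.map_subst (PowerSeries.HasSubst.of_constantCoeff_zero
        F.law.zero_constantCoeff),
      MvPowerSeries.map_subst (MvPowerSeries.hasSubst_of_constantCoeff_zero fun i => by
        fin_cases i <;> simp [hz])] at h'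
    refine h'.trans ?_
    congr 1
    funext i
    fin_cases i <;> simp [PowerSeries.map_subst (hc _)]
  act_add a b := by
    have h' := congrArg (PowerSeries.map (φ : R →+* S)) (F.act_add a b)
    refine h'.trans ?_
    refine (MvPowerSeries.map_subst (MvPowerSeries.hasSubst_of_constantCoeff_zero fun i => by
      fin_cases i
      · exact F.act_constantCoeff a
      · exact F.act_constantCoeff b) _).trans ?_
    congr 1
    funext i
    fin_cases i <;> rfl
  act_mul a b := by
    rw [F.act_mul]
    exact PowerSeries.map_subst
      (PowerSeries.HasSubst.of_constantCoeff_zero' (F.act_constantCoeff b)) _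
  act_one := by rw [F.act_one, PowerSeries.map_X]

/-- The formal `A`-module underlying a formal `B`-module, for `B` an `A`-algebra. -/
def restrictScalars (A : Type*) [CommRing A] [Algebra A B] [Algebra A R] [Algebra B R]
    [IsScalarTower A B R] (F : FormalModule B R) : FormalModule A R where
  law := F.law
  law_comm := F.law_comm
  act a := F.act (algebraMap A B a)
  act_constantCoeff a := F.act_constantCoeff _
  act_coeff_one a := by rw [F.act_coeff_one, ← IsScalarTower.algebraMap_apply]
  act_hom a := F.act_hom _
  act_add a b := by rw [map_add, F.act_add]
  act_mul a b := by rw [map_mul, F.act_mul]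
  act_one := by rw [map_one, F.act_one]

/-- `f` is the logarithm of the formal `A`-module `F` over `R`: the power series
`f(X) = X + ⋯` with coefficients in `ℚ ⊗ R` such that `f(F(X, Y)) = f(X) + f(Y)`.
(Over a `ℚ`-algebra, these conditions determine `f`.) -/
structure IsLogarithm (F : FormalModule A R) (f : PowerSeries (ℚ ⊗[ℤ] R)) : Prop where
  constantCoeff_eq : PowerSeries.constantCoeff f = 0
  coeff_one_eq : PowerSeries.coeff 1 f = 1
  subst_law : PowerSeries.subst (MvPowerSeries.map
      (Algebra.TensorProduct.includeRight : R →ₐ[ℤ] ℚ ⊗[ℤ] R).toRingHom F.law.toPowerSeries) f =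
    PowerSeries.subst (MvPowerSeries.X 0 : MvPowerSeries (Fin 2) (ℚ ⊗[ℤ] R)) f +
      PowerSeries.subst (MvPowerSeries.X 1 : MvPowerSeries (Fin 2) (ℚ ⊗[ℤ] R)) f

end FormalModule

section Typical

/-- The number `q` of elements of the residue field of a local ring `A`. -/
def residueCard (A : Type*) [CommRing A] [IsLocalRing A] : ℕ :=
  Nat.card (IsLocalRing.ResidueField A)

variable {A : Type u} [CommRing A] [IsLocalRing A]

/-- The logarithm of `F` involves only the powers `X ^ (q ^ k)`, where `q` is the cardinality of
the residue field of `A`. -/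
def FormalModule.HasTypicalLogarithm {R : Type u} [CommRing R] [Algebra A R]
    (F : FormalModule A R) : Prop :=
  ∃ f : PowerSeries (ℚ ⊗[ℤ] R), F.IsLogarithm f ∧
    ∀ n, (∀ k, n ≠ residueCard A ^ k) → PowerSeries.coeff n f = 0

/-- A formal `A`-module over `R` is `A`-typical if its logarithm involves only the powers
`X ^ (q ^ k)`. When `R` has torsion, so that the logarithm loses information, this means that
the formal `A`-module is the pushforward of one with this property over a torsion-free
`A`-algebra `S`. When `R` is torsion-free, one may take `S = R`. -/
def FormalModule.IsTypical {R : Type u} [CommRing R] [Algebra A R] (F : FormalModule A R) : Prop :=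
  ∃ (S : Type u) (_ : CommRing S) (_ : Algebra A S) (G : FormalModule A S) (φ : S →ₐ[A] R),
    Module.IsTorsionFree ℤ S ∧ G.HasTypicalLogarithm ∧ G.map φ = F

/-- `V` together with the formal `A`-module `F` over it is the classifying ring of `A`-typical
formal `A`-modules: `F` is `A`-typical, and each `A`-typical formal `A`-module over an `A`-algebra
`R` is the pushforward of `F` along exactly one homomorphism of `A`-algebras `V → R`. -/
def FormalModule.IsUniversalTypical {V : Type u} [CommRing V] [Algebra A V]
    (F : FormalModule A V) : Prop :=
  F.IsTypical ∧ ∀ (R : Type u) [CommRing R] [Algebra A R] (G : FormalModule A R),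
    G.IsTypical → ∃! φ : V →ₐ[A] R, F.map φ = G

/-- The sequence `v₀, v₁, v₂, …` in `V` is the sequence of Hazewinkel generators associated to the
element `ϖ` (a uniformizer of `A`) and to the formal `A`-module `F` (the universal one):
`v₀ = ϖ`, and `ϖ ℓ_n = ∑_{i < n} ℓ_i v_{n-i} ^ (q ^ i)` in `ℚ ⊗ V` for all `n ≥ 1`, where `ℓ_n` is
the coefficient of `X ^ (q ^ n)` in the logarithm of `F`. -/
def FormalModule.IsHazewinkelSequence {V : Type u} [CommRing V] [Algebra A V]
    (F : FormalModule A V) (ϖ : A) (v : ℕ → V) : Prop :=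
  v 0 = algebraMap A V ϖ ∧ ∃ f : PowerSeries (ℚ ⊗[ℤ] V), F.IsLogarithm f ∧ ∀ n, 1 ≤ n →
    ((1 : ℚ) ⊗ₜ[ℤ] algebraMap A V ϖ) * PowerSeries.coeff (residueCard A ^ n) f =
      ∑ i ∈ Finset.range n, PowerSeries.coeff (residueCard A ^ i) f *
        ((1 : ℚ) ⊗ₜ[ℤ] v (n - i)) ^ (residueCard A ^ i)

end Typical

end

/-! Over a torsion-free ring a formal module is determined by its logarithm, and a typical logarithm
by its Hazewinkel generators. Since `L/K` is unramified, `q_B = q_A ^ f`, so the logarithm of `F^B`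
is also a series in the powers `X ^ (q_A ^ n)`: its `n`-th coefficient is `ℓ^B_{n/f}` if `f ∣ n`,
and `0` otherwise. Hence `F^B` is `A`-typical, and `γ` maps `ℓ^A_n` to this coefficient. The
sequence that is `v^B_{n/f}` for `f ∣ n` and `0` otherwise satisfies the Hazewinkel relations of `A`
for these coefficients, because `q_A ^ (f i) = q_B ^ i`. The relations have at most one solution in
a torsion-free ring, as `v_n` enters the `n`-th one linearly with coefficient `ℓ_0 = 1`; this gives
the values of `γ`. The isomorphism follows because `V^A` and `V^B` are polynomial rings on `v_1,
v_2, …`: after base change to `B` and killing the `v^A_i` with `f ∤ i`, the variables left are the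
`v^A_{fj}`, which correspond to the `v^B_j`.

Most of the work goes into showing that `V^A` is this polynomial ring.

Existence: on `A[X_0, X_1, …]` the endomorphism `σ` raising each variable to its `q`-th power lifts
Frobenius modulo `ϖ`. Hazewinkel's functional equation lemma (`FrobeniusLift.exists_subst_log_eq`)
then shows that `f⁻¹(f(X) + f(Y))` and `f⁻¹(a f(X))` have integral coefficients, which yields a
formal module with the prescribed generators.

Classification over torsion-free rings: if two logarithms agree below degree `N = q ^ (n + 1)`, the
series `[ϖ]` differ in degree `N` by `(1 - ϖ ^ (N - 1))` times the difference of `ϖ ℓ_{n+1}`. The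
first factor is a unit and the series are integral, so each next Hazewinkel generator is integral
(`exists_hazewinkelRelation`).

Uniqueness over arbitrary rings: the same comparison inside the polynomial ring expresses each
variable through a coefficient of `[ϖ]` and the earlier variables (`algHom_ext_of_map_eq`). -/

noncomputable section

/-! ### Power series up to a given degree -/

section DegreeFiltration

variable {τ R : Type*} [CommRing R]

namespace MvPowerSeries

variable (τ R) in
/-- The ideal of the power series all of whose terms have degree at least `N`. -/
def orderIdeal (N : ℕ) : Ideal (MvPowerSeries τ R) where
  carrier := {x | (N : ℕ∞) ≤ x.order}
  zero_mem' := by simp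
  add_mem' {x y} hx hy := (le_min hx hy).trans min_order_le_add
  smul_mem' c x hx := by
    rw [smul_eq_mul]
    exact (le_add_left (show (N : ℕ∞) ≤ x.order from hx)).trans le_order_mul

theorem mem_orderIdeal {N : ℕ} {x : MvPowerSeries τ R} :
    x ∈ orderIdeal τ R N ↔ (N : ℕ∞) ≤ x.order := Iff.rfl

theorem mem_orderIdeal_iff_coeff {N : ℕ} {x : MvPowerSeries τ R} :
    x ∈ orderIdeal τ R N ↔ ∀ d : τ →₀ ℕ, d.degree < N → coeff d x = 0 :=
  ⟨fun h _ hd => coeff_of_lt_order ((Nat.cast_lt.2 hd).trans_le h), fun h => nat_le_order h⟩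

theorem mem_orderIdeal_one {x : MvPowerSeries τ R} :
    x ∈ orderIdeal τ R 1 ↔ constantCoeff x = 0 := by
  rw [mem_orderIdeal, Nat.cast_one, one_le_order_iff_constCoeff_eq_zero]

theorem orderIdeal_antitone {M N : ℕ} (h : M ≤ N) : orderIdeal τ R N ≤ orderIdeal τ R M :=
  fun _ hx => (Nat.cast_le.2 h).trans (mem_orderIdeal.1 hx)

theorem mul_mem_orderIdeal {M N : ℕ} {x y : MvPowerSeries τ R} (hx : x ∈ orderIdeal τ R M)
    (hy : y ∈ orderIdeal τ R N) : x * y ∈ orderIdeal τ R (M + N) := by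
  rw [mem_orderIdeal] at *
  push_cast
  exact (add_le_add hx hy).trans le_order_mul

theorem pow_mem_orderIdeal {x : MvPowerSeries τ R} (hx : constantCoeff x = 0) (n : ℕ) :
    x ^ n ∈ orderIdeal τ R n :=
  le_order_pow_of_constantCoeff_eq_zero n hx

theorem map_mem_orderIdeal {S : Type*} [CommRing S] (φ : R →+* S) {N : ℕ} {x : MvPowerSeries τ R}
    (hx : x ∈ orderIdeal τ R N) : map φ x ∈ orderIdeal τ S N :=
  hx.trans (le_order_map φ)

theorem expand_mem_orderIdeal {m : ℕ} (hm : m ≠ 0) {N : ℕ} {x : MvPowerSeries τ R}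
    (hx : x ∈ orderIdeal τ R N) : expand m hm x ∈ orderIdeal τ R (m * N) := by
  rw [mem_orderIdeal] at *
  rw [order_expand, nsmul_eq_mul]
  push_cast
  gcongr

theorem sub_pow_mem_orderIdeal {N : ℕ} {x y : MvPowerSeries τ R} (h : x - y ∈ orderIdeal τ R N)
    (m : ℕ) : x ^ m - y ^ m ∈ orderIdeal τ R N :=
  Ideal.mem_of_dvd _ (sub_dvd_pow_sub_pow x y m) h

/-- In the factorization of `x ^ m - y ^ m` by `x - y`, the cofactor has no constant term once `m ≥
2`; this gains one degree. -/
theorem sub_pow_mem_orderIdeal_succ {N : ℕ} {x y : MvPowerSeries τ R} (hx : constantCoeff x = 0)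
    (hy : constantCoeff y = 0) (h : x - y ∈ orderIdeal τ R N) {m : ℕ} (hm : 2 ≤ m) :
    x ^ m - y ^ m ∈ orderIdeal τ R (N + 1) := by
  rw [← (Commute.all x y).mul_geom_sum₂ m]
  refine mul_mem_orderIdeal h (mem_orderIdeal_one.2 ?_)
  rw [map_sum]
  refine Finset.sum_eq_zero fun i hi => ?_
  rw [map_mul, map_pow, map_pow, hx, hy]
  rcases Nat.eq_zero_or_pos i with rfl | h0
  · rw [zero_pow (n := m - 1 - 0) (by omega), mul_zero]
  · rw [zero_pow h0.ne', zero_mul]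

theorem eq_of_forall_sub_mem_orderIdeal {x y : MvPowerSeries τ R}
    (h : ∀ N, x - y ∈ orderIdeal τ R N) : x = y := by
  ext d
  have := mem_orderIdeal_iff_coeff.1 (h (d.degree + 1)) d (Nat.lt_succ_self _)
  rwa [map_sub, sub_eq_zero] at this

end MvPowerSeries

namespace PowerSeries

open MvPowerSeries (orderIdeal mem_orderIdeal_iff_coeff)

theorem subst_mem_orderIdeal {x : MvPowerSeries τ R} (hx : MvPowerSeries.constantCoeff x = 0)
    {f : PowerSeries R} {N : ℕ} (hf : ∀ m < N, coeff m f = 0) :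
    subst x f ∈ orderIdeal τ R N := by
  refine mem_orderIdeal_iff_coeff.2 fun d hd => ?_
  rw [coeff_subst (HasSubst.of_constantCoeff_zero hx)]
  refine finsum_eq_zero_of_forall_eq_zero fun m => ?_
  rcases lt_or_ge m N with h | h
  · rw [hf m h, zero_smul]
  · rw [mem_orderIdeal_iff_coeff.1 (MvPowerSeries.pow_mem_orderIdeal hx m) d (hd.trans_le h),
      smul_zero]

theorem subst_sub_subst_mem_orderIdeal {x y : MvPowerSeries τ R}
    (hx : MvPowerSeries.constantCoeff x = 0) (hy : MvPowerSeries.constantCoeff y = 0)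
    (f : PowerSeries R) {N : ℕ} (h : x - y ∈ orderIdeal τ R N) :
    subst x f - subst y f ∈ orderIdeal τ R N := by
  refine mem_orderIdeal_iff_coeff.2 fun d hd => ?_
  rw [map_sub, coeff_subst (HasSubst.of_constantCoeff_zero hx),
    coeff_subst (HasSubst.of_constantCoeff_zero hy), sub_eq_zero]
  refine finsum_congr fun m => ?_
  have := mem_orderIdeal_iff_coeff.1 (MvPowerSeries.sub_pow_mem_orderIdeal h m) d hd
  rw [map_sub, sub_eq_zero] at this
  rw [this]

theorem subst_sub_subst_mem_orderIdeal_succ {x y : MvPowerSeries τ R}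
    (hx : MvPowerSeries.constantCoeff x = 0) (hy : MvPowerSeries.constantCoeff y = 0)
    {f : PowerSeries R} (hf : coeff 1 f = 0) {N : ℕ} (h : x - y ∈ orderIdeal τ R N) :
    subst x f - subst y f ∈ orderIdeal τ R (N + 1) := by
  refine mem_orderIdeal_iff_coeff.2 fun d hd => ?_
  rw [map_sub, coeff_subst (HasSubst.of_constantCoeff_zero hx),
    coeff_subst (HasSubst.of_constantCoeff_zero hy), sub_eq_zero]
  refine finsum_congr fun m => ?_
  obtain rfl | rfl | hm : m = 0 ∨ m = 1 ∨ 2 ≤ m := by omega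
  · rw [pow_zero, pow_zero]
  · rw [hf, zero_smul, zero_smul]
  · have := mem_orderIdeal_iff_coeff.1
      (MvPowerSeries.sub_pow_mem_orderIdeal_succ hx hy h hm) d hd
    rw [map_sub, sub_eq_zero] at this
    rw [this]

/-- Only the linear term of `f` fails to gain a degree, so it is split off as `X`. -/
theorem subst_sub_subst_sub_mem_orderIdeal {x y : MvPowerSeries τ R}
    (hx : MvPowerSeries.constantCoeff x = 0) (hy : MvPowerSeries.constantCoeff y = 0)
    {f : PowerSeries R} (hf : coeff 1 f = 1) {N : ℕ} (h : x - y ∈ orderIdeal τ R N) :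
    subst x f - subst y f - (x - y) ∈ orderIdeal τ R (N + 1) := by
  have h1 := subst_sub_subst_mem_orderIdeal_succ hx hy (f := f - X) (by simp [hf]) h
  have hx' := HasSubst.of_constantCoeff_zero hx
  have hy' := HasSubst.of_constantCoeff_zero hy
  rw [← coe_substAlgHom (R := R) hx', ← coe_substAlgHom (R := R) hy', map_sub, map_sub,
    coe_substAlgHom, coe_substAlgHom, subst_X hx', subst_X hy'] at h1
  convert h1 using 1
  ring

theorem subst_sub_self_mem_orderIdeal_two {x : MvPowerSeries τ R}
    (hx : MvPowerSeries.constantCoeff x = 0) {f : PowerSeries R} (hf0 : constantCoeff f = 0)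
    (hf : coeff 1 f = 1) : subst x f - x ∈ orderIdeal τ R 2 := by
  have h := subst_sub_subst_sub_mem_orderIdeal hx (map_zero _) hf (N := 1) (y := 0)
    (by rw [sub_zero]; exact MvPowerSeries.mem_orderIdeal_one.2 hx)
  rwa [subst_zero_of_constantCoeff_zero hf0, sub_zero, sub_zero] at h

/-! ### Compositional inverses of series with linear term `X`. -/

section Inverse

variable {f : PowerSeries R} (hf0 : constantCoeff f = 0) (hf : coeff 1 f = 1)
include hf0 hf

theorem exists_subst_inverse : ∃ g : PowerSeries R, constantCoeff g = 0 ∧ coeff 1 g = 1 ∧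
    subst g f = (X : PowerSeries R) ∧ subst f g = (X : PowerSeries R) := by
  have hu : IsUnit (coeff 1 f) := hf ▸ isUnit_one
  refine ⟨f.substInvOfIsUnit hu, by simp, ?_, subst_substInvOfIsUnit_right f hf0 hu,
    subst_substInvOfIsUnit_left f hf0 hu⟩
  rw [coeff_one_substInvOfIsUnit, inv_eq_one.2 (Units.ext hf : hu.unit = 1), Units.val_one]

/-- The compositional inverse of `f` recovers `x` and `y`, and substitution into it preserves
congruences. -/
theorem sub_mem_orderIdeal_of_subst {x y : MvPowerSeries τ R}
    (hx : MvPowerSeries.constantCoeff x = 0) (hy : MvPowerSeries.constantCoeff y = 0) {N : ℕ}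
    (h : subst x f - subst y f ∈ orderIdeal τ R N) : x - y ∈ orderIdeal τ R N := by
  obtain ⟨g, hg0, -, -, hg⟩ := exists_subst_inverse hf0 hf
  have key : ∀ z : MvPowerSeries τ R, MvPowerSeries.constantCoeff z = 0 →
      subst (subst z f) g = z := fun z hz => by
    rw [← subst_comp_subst_apply (HasSubst.of_constantCoeff_zero' hf0)
      (HasSubst.of_constantCoeff_zero hz), hg, subst_X (HasSubst.of_constantCoeff_zero hz)]
  have := subst_sub_subst_mem_orderIdeal (constantCoeff_subst_eq_zero hx f hf0)
    (constantCoeff_subst_eq_zero hy f hf0) g h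
  rwa [key x hx, key y hy] at this

theorem subst_left_injective {x y : MvPowerSeries τ R}
    (hx : MvPowerSeries.constantCoeff x = 0) (hy : MvPowerSeries.constantCoeff y = 0)
    (h : subst x f = subst y f) : x = y :=
  MvPowerSeries.eq_of_forall_sub_mem_orderIdeal fun N =>
    sub_mem_orderIdeal_of_subst hf0 hf hx hy (by rw [h, sub_self]; exact zero_mem _)

theorem exists_subst_eq {h : MvPowerSeries τ R} (hh : MvPowerSeries.constantCoeff h = 0) :
    ∃ u : MvPowerSeries τ R, MvPowerSeries.constantCoeff u = 0 ∧ subst u f = h := by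
  obtain ⟨g, hg0, -, hg, -⟩ := exists_subst_inverse hf0 hf
  refine ⟨subst h g, constantCoeff_subst_eq_zero hh g hg0, ?_⟩
  rw [← subst_comp_subst_apply (HasSubst.of_constantCoeff_zero' hg0)
      (HasSubst.of_constantCoeff_zero hh), hg, subst_X (HasSubst.of_constantCoeff_zero hh)]

end Inverse

theorem coeff_subst_of_forall_lt {x f : PowerSeries R} (hx : constantCoeff x = 0) {N : ℕ}
    (hf : ∀ m < N, coeff m f = 0) :
    coeff N (subst x f : PowerSeries R) = coeff N f * coeff 1 x ^ N := by
  rw [coeff_subst' (HasSubst.of_constantCoeff_zero' hx), finsum_eq_single _ N]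
  · obtain ⟨y, rfl⟩ := X_dvd_iff.2 hx
    rw [mul_pow, coeff_X_pow_mul' , if_pos le_rfl, Nat.sub_self, smul_eq_mul,
      show (1 : ℕ) = 0 + 1 from rfl, coeff_succ_X_mul, coeff_zero_eq_constantCoeff, map_pow]
  · intro m hm
    rcases lt_or_gt_of_ne hm with h | h
    · rw [hf m h, zero_smul]
    · rw [coeff_of_lt_order N ((Nat.cast_lt.2 h).trans_le
        (le_order_pow_of_constantCoeff_eq_zero m hx)), smul_zero]

end PowerSeries

/-- If the logarithms `f` and `f'` agree in degrees below `N`, then the series `f⁻¹(a f(X))` and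
`f'⁻¹(a f'(X))` differ in degree `N` by `(a - a ^ N) (f_N - f'_N)`. -/
theorem PowerSeries.coeff_sub_coeff_of_subst_eq_mul {f f' x x' : PowerSeries R} {a : R}
    (hf0 : constantCoeff f = 0) (hf : coeff 1 f = 1)
    (hx0 : constantCoeff x = 0) (hx0' : constantCoeff x' = 0) (hx' : coeff 1 x' = a)
    (h : (subst x f : PowerSeries R) = C a * f) (h' : (subst x' f' : PowerSeries R) = C a * f')
    {N : ℕ} (hN : ∀ m < N, coeff m f = coeff m f') :
    coeff N x - coeff N x' = (a - a ^ N) * (coeff N f - coeff N f') := by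
  have hd : ∀ m < N, coeff m (f - f') = 0 := fun m hm => by rw [map_sub, hN m hm, sub_self]
  have hs' := HasSubst.of_constantCoeff_zero' hx0'
  have e1 : (subst x' (f - f') : PowerSeries R) = subst x' f - subst x' f' := by
    rw [← coe_substAlgHom (R := R) hs', map_sub]
  -- The right-hand side involves only `f - f'`, which starts in degree `N`. Hence so does `x - x'`,
  -- and in degree `N` it coincides with `f(x) - f(x')`.
  have e2 : (subst x f : PowerSeries R) - subst x' f = C a * (f - f') - subst x' (f - f') := by
    rw [e1, h, h']
    ring
  have m1 : (subst x f : PowerSeries R) - subst x' f ∈ MvPowerSeries.orderIdeal Unit R N := by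
    rw [e2]
    refine sub_mem (Ideal.mul_mem_left _ _ ?_) (subst_mem_orderIdeal hx0' hd)
    have := subst_mem_orderIdeal (x := (X : PowerSeries R)) constantCoeff_X hd
    rwa [X_subst] at this
  have m2 := sub_mem_orderIdeal_of_subst hf0 hf hx0 hx0' m1
  have m3 := subst_sub_subst_sub_mem_orderIdeal hx0 hx0' hf m2
  have m4 := MvPowerSeries.mem_orderIdeal_iff_coeff.1 m3 (Finsupp.single () N) (by simp)
  rw [e2] at m4
  have m5 : coeff N (C a * (f - f') - subst x' (f - f') - (x - x')) = 0 := m4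
  rw [map_sub, map_sub, coeff_C_mul, coeff_subst_of_forall_lt hx0' hd, hx', map_sub, map_sub] at m5
  linear_combination -m5

end DegreeFiltration

/-! ### Divisibility of power series by constants -/

theorem MvPowerSeries.exists_forall_coeff_eq {τ R : Type*} [CommRing R] (c : (τ →₀ ℕ) → R) :
    ∃ x : MvPowerSeries τ R, ∀ d, MvPowerSeries.coeff d x = c d :=
  ⟨c, fun _ => rfl⟩

theorem MvPowerSeries.C_dvd_of_forall_coeff {τ R : Type*} [CommRing R] {a : R}
    {x : MvPowerSeries τ R} (h : ∀ d, a ∣ MvPowerSeries.coeff d x) : MvPowerSeries.C a ∣ x := by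
  choose c hc using h
  obtain ⟨y, hy⟩ := MvPowerSeries.exists_forall_coeff_eq c
  refine ⟨y, ?_⟩
  ext d
  rw [MvPowerSeries.coeff_C_mul, hc, hy]

/-- The cofactor of `x - y` in `x ^ p - y ^ p` is, modulo `ϖ`, `p` times a power, so it supplies one
more factor `ϖ`. -/
theorem pow_succ_dvd_pow_sub_pow {R : Type*} [CommRing R] {ϖ x y : R} {p : ℕ} (hp : ϖ ∣ (p : R))
    {j : ℕ} (hj : j ≠ 0) (h : ϖ ^ j ∣ x - y) : ϖ ^ (j + 1) ∣ x ^ p - y ^ p := by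
  rw [← (Commute.all x y).mul_geom_sum₂ p, pow_succ]
  exact mul_dvd_mul h ((dvd_geom_sum₂_iff_of_dvd_sub ((dvd_pow_self ϖ hj).trans h)).2
    (hp.mul_right _))

theorem pow_succ_dvd_pow_pow_sub_pow_pow {R : Type*} [CommRing R] {ϖ x y : R} {p : ℕ}
    (hp : ϖ ∣ (p : R)) (h : ϖ ∣ x - y) (k : ℕ) : ϖ ^ (k + 1) ∣ x ^ p ^ k - y ^ p ^ k := by
  induction k with
  | zero => simpa using h
  | succ k ih =>
    rw [pow_succ p, pow_mul, pow_mul]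
    exact pow_succ_dvd_pow_sub_pow hp k.succ_ne_zero ih

/-! ### Series with exponents the powers of `q` -/

section TypicalSeries

variable {P : Type*} [CommRing P]

/-- The power series `∑ ℓ_k X ^ (q ^ k)`. -/
def typicalSeries (q : ℕ) (ℓ : ℕ → P) : PowerSeries P :=
  -- For `m = 0` the logarithm is `0` by convention and `q ^ 0 ≠ 0`, so the constant term vanishes.
  PowerSeries.mk fun m => if q ^ Nat.log q m = m then ℓ (Nat.log q m) else 0

variable {q : ℕ} (ℓ : ℕ → P)

theorem coeff_typicalSeries_pow (hq : 1 < q) (k : ℕ) :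
    PowerSeries.coeff (q ^ k) (typicalSeries q ℓ) = ℓ k := by
  rw [typicalSeries, PowerSeries.coeff_mk, Nat.log_pow hq, if_pos rfl]

theorem coeff_typicalSeries_of_ne {m : ℕ} (hm : ∀ k, m ≠ q ^ k) :
    PowerSeries.coeff m (typicalSeries q ℓ) = 0 := by
  rw [typicalSeries, PowerSeries.coeff_mk, if_neg fun h => hm _ h.symm]

theorem constantCoeff_typicalSeries (hq : 1 < q) :
    PowerSeries.constantCoeff (typicalSeries q ℓ) = 0 := by
  rw [← PowerSeries.coeff_zero_eq_constantCoeff_apply]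
  exact coeff_typicalSeries_of_ne ℓ fun k => (pow_pos (by omega) k).ne

theorem coeff_one_typicalSeries (hq : 1 < q) :
    PowerSeries.coeff 1 (typicalSeries q ℓ) = ℓ 0 := by
  simpa using coeff_typicalSeries_pow ℓ hq 0

theorem eq_typicalSeries {f : PowerSeries P} (hq : 1 < q)
    (hf : ∀ m, (∀ k, m ≠ q ^ k) → PowerSeries.coeff m f = 0) :
    f = typicalSeries q fun k => PowerSeries.coeff (q ^ k) f := by
  ext m
  by_cases h : ∃ k, m = q ^ k
  · obtain ⟨k, rfl⟩ := h
    rw [coeff_typicalSeries_pow _ hq]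
  · push Not at h
    rw [hf m h, coeff_typicalSeries_of_ne _ h]

theorem map_typicalSeries {Q : Type*} [CommRing Q] (φ : P →+* Q) :
    PowerSeries.map φ (typicalSeries q ℓ) = typicalSeries q fun k => φ (ℓ k) := by
  ext m
  rw [PowerSeries.coeff_map, typicalSeries, typicalSeries, PowerSeries.coeff_mk,
    PowerSeries.coeff_mk, apply_ite φ, map_zero]

end TypicalSeries

/-! ### The functional equation lemma -/

/-- The data of the functional equation lemma: a subring `ι : V → P`, an element `ϖ` of `V` that
is invertible in `P` and divides `p`, and an endomorphism `σ` of the pair that fixes `ϖ` and lifts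
the `q`-th power map modulo `ϖ`, where `q = p ^ r`. -/
structure FrobeniusLift (p r : ℕ) (V P : Type*) [CommRing V] [CommRing P] where
  ι : V →+* P
  ϖ : V
  invϖ : P
  σ : V →+* V
  σP : P →+* P
  prime : p.Prime
  r_ne_zero : r ≠ 0
  ι_injective : Function.Injective ι
  ι_mul_invϖ : ι ϖ * invϖ = 1
  σP_ι : ∀ x, σP (ι x) = ι (σ x)
  σ_ϖ : σ ϖ = ϖ
  ϖ_dvd_p : ϖ ∣ (p : V)
  ϖ_dvd_σ_sub_pow : ∀ x, ϖ ∣ σ x - x ^ p ^ r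

namespace FrobeniusLift

variable {p r : ℕ} {V P : Type*} [CommRing V] [CommRing P] (D : FrobeniusLift p r V P)

include D in
theorem one_lt_q : 1 < p ^ r := Nat.one_lt_pow D.r_ne_zero D.prime.one_lt

include D in
theorem q_ne_zero : p ^ r ≠ 0 := (pow_pos D.prime.pos r).ne'

theorem σP_pow_ι (i : ℕ) (x : V) : (D.σP ^ i) (D.ι x) = D.ι ((D.σ ^ i) x) := by
  induction i generalizing x with
  | zero => rfl
  | succ i ih =>
    rw [pow_succ, pow_succ, RingHom.mul_def, RingHom.mul_def, RingHom.comp_apply, D.σP_ι, ih,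
      RingHom.comp_apply]

theorem σ_pow_ϖ (i : ℕ) : (D.σ ^ i) D.ϖ = D.ϖ := by
  induction i with
  | zero => rfl
  | succ i ih => rw [pow_succ, RingHom.mul_def, RingHom.comp_apply, D.σ_ϖ, ih]

theorem cancel_ϖ {x y : P} (h : D.ι D.ϖ * x = D.ι D.ϖ * y) : x = y := by
  linear_combination D.invϖ * h + (y - x) * D.ι_mul_invϖ

/-- The coefficients of the logarithm, given by
`ϖ ℓ_n = ∑ v_i σ^i(ℓ_{n-i})`, the sum being over `1 ≤ i ≤ n`. -/
def logCoeff (v : ℕ → V) : ℕ → P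
  | 0 => 1
  | n + 1 => D.invϖ * ∑ i : Fin (n + 1), D.ι (v (i + 1)) * (D.σP ^ (i.1 + 1)) (logCoeff v (n - i))

variable (v : ℕ → V)

theorem logCoeff_zero : D.logCoeff v 0 = 1 := by rw [logCoeff]

theorem ϖ_mul_logCoeff_succ (n : ℕ) : D.ι D.ϖ * D.logCoeff v (n + 1) =
    ∑ i ∈ Finset.range (n + 1), D.ι (v (i + 1)) * (D.σP ^ (i + 1)) (D.logCoeff v (n - i)) := by
  rw [logCoeff, ← mul_assoc, D.ι_mul_invϖ, one_mul,
    Fin.sum_univ_eq_sum_range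
      (fun i => D.ι (v (i + 1)) * (D.σP ^ (i + 1)) (D.logCoeff v (n - i))) (n + 1)]

/-- Both recursions expand `ℓ_n` as a sum over the compositions of `n`; the definition splits off
the first part of a composition, Hazewinkel's relation the last. -/
theorem ϖ_mul_logCoeff (hv : ∀ i, D.σ (v (i + 1)) = v (i + 1) ^ p ^ r) {n : ℕ} (hn : 1 ≤ n) :
    D.ι D.ϖ * D.logCoeff v n =
      ∑ i ∈ Finset.range n, D.logCoeff v i * D.ι (v (n - i)) ^ (p ^ r) ^ i := by
  have hv' : ∀ i j, (D.σP ^ i) (D.ι (v (j + 1))) = D.ι (v (j + 1)) ^ (p ^ r) ^ i := by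
    intro i j
    induction i with
    | zero => simp
    | succ i ih =>
      rw [pow_succ, RingHom.mul_def, RingHom.comp_apply, D.σP_ι, hv, map_pow, map_pow, ih,
        ← pow_mul, pow_succ]
  induction n using Nat.strong_induction_on with
  | _ n ih =>
  obtain ⟨N, rfl⟩ : ∃ N, n = N + 1 := ⟨n - 1, by omega⟩
  -- A second factor `ϖ` lets the induction hypothesis act on the inner `ℓ_{n-i}`. The term with
  -- `ℓ_0`, for which there is no relation, is kept apart on either side; the remaining double sum
  -- is regrouped along `i + j`.
  refine D.cancel_ϖ ?_
  have h1 : ∀ i ∈ Finset.range N,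
      D.ι D.ϖ * (D.ι (v (i + 1)) * (D.σP ^ (i + 1)) (D.logCoeff v (N - i))) =
      ∑ j ∈ Finset.range (N - i), D.ι (v (i + 1)) * (D.σP ^ (i + 1)) (D.logCoeff v j) *
        D.ι (v (N - (i + j))) ^ (p ^ r) ^ (i + j + 1) := by
    intro i hi
    rw [Finset.mem_range] at hi
    rw [mul_left_comm]
    conv_lhs => rw [← D.σ_pow_ϖ (i + 1), ← D.σP_pow_ι, ← map_mul, ih (N - i) (by omega) (by omega),
      map_sum, Finset.mul_sum]
    refine Finset.sum_congr rfl fun j hj => ?_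
    rw [Finset.mem_range] at hj
    obtain ⟨k, hk⟩ : ∃ k, N - i - j = k + 1 := ⟨N - i - j - 1, by omega⟩
    rw [map_mul, map_pow, hk, hv', ← Nat.sub_sub, hk, ← pow_mul, ← pow_add, mul_assoc]
    congr 4
    omega
  rw [D.ϖ_mul_logCoeff_succ, Finset.mul_sum, Finset.sum_range_succ, Finset.sum_congr rfl h1,
    ← Finset.sum_range_diag_flip N fun i j => D.ι (v (i + 1)) * (D.σP ^ (i + 1)) (D.logCoeff v j) *
        D.ι (v (N - (i + j))) ^ (p ^ r) ^ (i + j + 1), Finset.sum_range_succ', mul_add,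
    Finset.mul_sum]
  congr 1
  · refine Finset.sum_congr rfl fun m _ => ?_
    rw [← mul_assoc, D.ϖ_mul_logCoeff_succ, Finset.sum_mul]
    refine Finset.sum_congr rfl fun i hi => ?_
    rw [Finset.mem_range] at hi
    rw [Nat.add_sub_cancel' (by omega : i ≤ m), Nat.add_sub_add_right]
  · simp [logCoeff_zero]

/-- The logarithm `f(X) = ∑ ℓ_n X ^ (q ^ n)`. -/
def log : PowerSeries P := typicalSeries (p ^ r) (D.logCoeff v)

theorem constantCoeff_log : PowerSeries.constantCoeff (D.log v) = 0 :=
  constantCoeff_typicalSeries _ D.one_lt_q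

theorem coeff_one_log : PowerSeries.coeff 1 (D.log v) = 1 := by
  rw [log, coeff_one_typicalSeries _ D.one_lt_q, logCoeff_zero]

/-- The functional equation of the logarithm, in degrees below `N`. -/
theorem coeff_log_functionalEquation {m N : ℕ} (hm : m < N) :
    PowerSeries.coeff m (PowerSeries.C (D.ι D.ϖ) * (D.log v - PowerSeries.X) -
      ∑ i ∈ Finset.range N, PowerSeries.C (D.ι (v (i + 1))) *
        PowerSeries.subst (PowerSeries.X ^ (p ^ r) ^ (i + 1) : PowerSeries P)
          (PowerSeries.map (D.σP ^ (i + 1)) (D.log v))) = 0 := by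
  have hq0 : ∀ i, (p ^ r) ^ i ≠ 0 := fun i => pow_ne_zero i D.q_ne_zero
  simp only [map_sub, map_sum, PowerSeries.coeff_C_mul,
    PowerSeries.coeff_subst_X_pow (hq0 _), log, map_typicalSeries]
  by_cases h : ∃ k, m = (p ^ r) ^ k
  · obtain ⟨k, rfl⟩ := h
    rw [coeff_typicalSeries_pow _ D.one_lt_q]
    rcases k with _ | k
    · rw [logCoeff_zero, pow_zero, PowerSeries.coeff_one_X, sub_self, mul_zero, zero_sub,
        neg_eq_zero]
      refine Finset.sum_eq_zero fun i _ => ?_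
      rw [if_neg, mul_zero]
      rw [Nat.dvd_one]
      exact (Nat.one_lt_pow i.succ_ne_zero D.one_lt_q).ne'
    · rw [PowerSeries.coeff_X, if_neg (Nat.one_lt_pow k.succ_ne_zero D.one_lt_q).ne', sub_zero,
        D.ϖ_mul_logCoeff_succ, sub_eq_zero]
      -- Since `k + 1 < q ^ (k + 1) < N`, truncation at `N` loses no term in this degree.
      have hkN : k + 1 ≤ N := (Nat.lt_pow_self D.one_lt_q).le.trans hm.le
      rw [← Finset.sum_subset (Finset.range_mono hkN)]
      · refine Finset.sum_congr rfl fun i hi => ?_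
        rw [Finset.mem_range] at hi
        rw [if_pos (pow_dvd_pow _ (by omega)), Nat.pow_div (by omega) (by have := D.one_lt_q; omega),
          Algebra.algebraMap_self, RingHom.id_apply, coeff_typicalSeries_pow _ D.one_lt_q,
          Nat.add_sub_add_right]
      · intro i _ hi
        rw [Finset.mem_range] at hi
        rw [if_neg, mul_zero]
        rw [Nat.pow_dvd_pow_iff_le_right D.one_lt_q]
        omega
  · push Not at h
    have h1 : m ≠ 1 := by simpa using h 0
    rw [coeff_typicalSeries_of_ne _ h, PowerSeries.coeff_X, if_neg h1, sub_zero, mul_zero,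
      zero_sub, neg_eq_zero]
    refine Finset.sum_eq_zero fun i _ => ?_
    split_ifs with hd
    · rw [coeff_typicalSeries_of_ne, map_zero, mul_zero]
      intro k hk
      obtain ⟨c, rfl⟩ := hd
      rw [Nat.mul_div_cancel_left _ (Nat.pos_of_ne_zero (hq0 _))] at hk
      exact h (i + 1 + k) (by rw [hk, ← pow_add])
    · rw [mul_zero]

variable {τ : Type*}

open MvPowerSeries (orderIdeal)

/-- Truncation avoids infinite sums of power series: the omitted terms are series in `x ^ (q ^ i)`
with `i > N`, of degree above `N`. -/
theorem subst_log_functionalEquation {x : MvPowerSeries τ P}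
    (hx : MvPowerSeries.constantCoeff x = 0) (N : ℕ) :
    MvPowerSeries.C (D.ι D.ϖ) * (PowerSeries.subst x (D.log v) - x) -
      ∑ i ∈ Finset.range N, MvPowerSeries.C (D.ι (v (i + 1))) *
        PowerSeries.subst (x ^ (p ^ r) ^ (i + 1))
          (PowerSeries.map (D.σP ^ (i + 1)) (D.log v)) ∈ orderIdeal τ P N := by
  have h := PowerSeries.subst_mem_orderIdeal hx
    (fun m hm => D.coeff_log_functionalEquation v (m := m) (N := N) hm)
  have hx' := PowerSeries.HasSubst.of_constantCoeff_zero hx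
  have hC : ∀ a : P, PowerSeries.subst x (PowerSeries.C a) = MvPowerSeries.C a :=
    fun a => PowerSeries.subst_C a
  rw [← PowerSeries.coe_substAlgHom (R := P) hx', map_sub, map_mul, map_sub, map_sum] at h
  simp only [map_mul, PowerSeries.coe_substAlgHom, hC, PowerSeries.subst_X hx'] at h
  have e : ∀ (i : ℕ) (g : PowerSeries P),
      PowerSeries.subst x (PowerSeries.subst (PowerSeries.X ^ (p ^ r) ^ i : PowerSeries P) g) =
        PowerSeries.subst (x ^ (p ^ r) ^ i) g := fun i g => by
    rw [PowerSeries.subst_comp_subst_apply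
      (PowerSeries.HasSubst.X_pow (pow_ne_zero _ D.q_ne_zero)) hx', PowerSeries.subst_pow hx',
      PowerSeries.subst_X hx']
  simpa only [e] using h

/-- The endomorphism `x ↦ x^{σ^i}(T ^ (q ^ i))` of a power series ring over `P`. -/
def frobP (i : ℕ) (x : MvPowerSeries τ P) : MvPowerSeries τ P :=
  MvPowerSeries.expand ((p ^ r) ^ i) (pow_ne_zero i D.q_ne_zero) (MvPowerSeries.map (D.σP ^ i) x)

/-- The endomorphism `x ↦ x^{σ^i}(T ^ (q ^ i))` of a power series ring over `V`. -/
def frobV (i : ℕ) (x : MvPowerSeries τ V) : MvPowerSeries τ V :=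
  MvPowerSeries.expand ((p ^ r) ^ i) (pow_ne_zero i D.q_ne_zero) (MvPowerSeries.map (D.σ ^ i) x)

theorem frobP_map_ι (i : ℕ) (x : MvPowerSeries τ V) :
    D.frobP i (MvPowerSeries.map D.ι x) = MvPowerSeries.map D.ι (D.frobV i x) := by
  rw [frobP, frobV, MvPowerSeries.map_expand]
  congr 1
  ext d
  simp only [MvPowerSeries.coeff_map, D.σP_pow_ι]

theorem constantCoeff_frobP (i : ℕ) {x : MvPowerSeries τ P}
    (hx : MvPowerSeries.constantCoeff x = 0) :
    MvPowerSeries.constantCoeff (D.frobP i x) = 0 := by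
  rw [frobP, MvPowerSeries.constantCoeff_expand, MvPowerSeries.constantCoeff_map, hx, map_zero]

theorem constantCoeff_frobV (i : ℕ) {x : MvPowerSeries τ V}
    (hx : MvPowerSeries.constantCoeff x = 0) :
    MvPowerSeries.constantCoeff (D.frobV i x) = 0 := by
  rw [frobV, MvPowerSeries.constantCoeff_expand, MvPowerSeries.constantCoeff_map, hx, map_zero]

theorem frobP_add (i : ℕ) (x y : MvPowerSeries τ P) :
    D.frobP i (x + y) = D.frobP i x + D.frobP i y := by
  rw [frobP, map_add, map_add]; rfl

theorem frobP_sub (i : ℕ) (x y : MvPowerSeries τ P) :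
    D.frobP i (x - y) = D.frobP i x - D.frobP i y := by
  rw [frobP, map_sub, map_sub]; rfl

theorem frobP_C_mul (i : ℕ) (a : P) (x : MvPowerSeries τ P) :
    D.frobP i (MvPowerSeries.C a * x) = MvPowerSeries.C ((D.σP ^ i) a) * D.frobP i x := by
  rw [frobP, map_mul, map_mul, MvPowerSeries.map_C, MvPowerSeries.expand_C]; rfl

theorem frobP_X (i : ℕ) (s : τ) :
    D.frobP i (MvPowerSeries.X s) = MvPowerSeries.X s ^ (p ^ r) ^ i := by
  rw [frobP, MvPowerSeries.map_X, MvPowerSeries.expand_X]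

theorem frobP_subst (i : ℕ) {x : MvPowerSeries τ P} (hx : MvPowerSeries.constantCoeff x = 0)
    (f : PowerSeries P) : D.frobP i (PowerSeries.subst x f) =
      PowerSeries.subst (D.frobP i x) (PowerSeries.map (D.σP ^ i) f) := by
  have hx' := PowerSeries.HasSubst.of_constantCoeff_zero hx
  rw [frobP, PowerSeries.map_subst hx', PowerSeries.expand_subst]
  · rfl
  · refine PowerSeries.HasSubst.of_constantCoeff_zero ?_
    rw [MvPowerSeries.constantCoeff_map, hx, map_zero]

theorem frobP_mem_orderIdeal {i : ℕ} (hi : i ≠ 0) {N : ℕ} {x : MvPowerSeries τ P} (hN : N ≠ 0)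
    (hx : x ∈ orderIdeal τ P N) : D.frobP i x ∈ orderIdeal τ P (N + 1) := by
  refine MvPowerSeries.orderIdeal_antitone ?_
    (MvPowerSeries.expand_mem_orderIdeal (pow_ne_zero i D.q_ne_zero)
      (MvPowerSeries.map_mem_orderIdeal (D.σP ^ i) hx))
  have h2 : 2 ≤ (p ^ r) ^ i := Nat.one_lt_pow hi D.one_lt_q
  calc N + 1 ≤ 2 * N := by omega
    _ ≤ _ := Nat.mul_le_mul_right _ h2

/-- Modulo `ϖ` the characteristic is `p` and `σ` becomes the `q`-th power map; there, a `q`-th power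
is formed by raising coefficients and variables to the `q`-th power. -/
theorem C_ϖ_dvd_frobV_one_sub_pow (x : MvPowerSeries τ V) :
    MvPowerSeries.C D.ϖ ∣ MvPowerSeries.expand (p ^ r) D.q_ne_zero (MvPowerSeries.map D.σ x) -
      x ^ p ^ r := by
  let I : Ideal V := Ideal.span {D.ϖ}
  have hp0 : ((p : ℕ) : V ⧸ I) = 0 := by
    rw [← map_natCast (Ideal.Quotient.mk I), Ideal.Quotient.eq_zero_iff_mem,
      Ideal.mem_span_singleton]
    exact D.ϖ_dvd_p
  suffices h : MvPowerSeries.map (Ideal.Quotient.mk I)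
      (MvPowerSeries.expand (p ^ r) D.q_ne_zero (MvPowerSeries.map D.σ x) - x ^ p ^ r) = 0 by
    refine MvPowerSeries.C_dvd_of_forall_coeff fun d => ?_
    have := congrArg (MvPowerSeries.coeff d) h
    rwa [MvPowerSeries.coeff_map, map_zero, Ideal.Quotient.eq_zero_iff_mem,
      Ideal.mem_span_singleton] at this
  rcases subsingleton_or_nontrivial (V ⧸ I) with hs | hs
  · ext d
    exact Subsingleton.elim _ _
  have : Fact p.Prime := ⟨D.prime⟩
  have : CharP (V ⧸ I) p := (CharP.charP_iff_prime_eq_zero D.prime).2 hp0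
  have hcomp : (Ideal.Quotient.mk I).comp D.σ =
      (iterateFrobenius (V ⧸ I) p r).comp (Ideal.Quotient.mk I) := by
    ext y
    rw [RingHom.comp_apply, RingHom.comp_apply, iterateFrobenius_def, ← map_pow,
      Ideal.Quotient.eq, Ideal.mem_span_singleton]
    exact D.ϖ_dvd_σ_sub_pow y
  rw [map_sub, map_pow, MvPowerSeries.map_expand, sub_eq_zero, ← RingHom.comp_apply,
    ← MvPowerSeries.map_comp, hcomp, MvPowerSeries.map_comp, RingHom.comp_apply,
    ← MvPowerSeries.map_expand, MvPowerSeries.map_iterateFrobenius_expand p D.prime.ne_zero]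

theorem C_ϖ_dvd_frobV_sub_pow (i : ℕ) (x : MvPowerSeries τ V) :
    MvPowerSeries.C D.ϖ ∣ D.frobV i x - x ^ (p ^ r) ^ i := by
  induction i with
  | zero =>
    have h1 : MvPowerSeries.map (1 : V →+* V) x = x := by
      rw [RingHom.one_def, MvPowerSeries.map_id, RingHom.id_apply]
    simp [frobV, h1]
  | succ i ih =>
    have h1 : D.frobV (i + 1) x = MvPowerSeries.expand (p ^ r) D.q_ne_zero
        (MvPowerSeries.map D.σ (D.frobV i x)) := by
      rw [frobV, frobV, MvPowerSeries.map_expand, ← MvPowerSeries.expand_mul]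
      simp only [pow_succ' D.σ, RingHom.mul_def, pow_succ' (p ^ r), MvPowerSeries.map_comp,
        RingHom.comp_apply]
    have h2 := D.C_ϖ_dvd_frobV_one_sub_pow (D.frobV i x)
    have h3 := ih.trans (sub_dvd_pow_sub_pow (D.frobV i x) (x ^ (p ^ r) ^ i) (p ^ r))
    rw [h1, pow_succ, pow_mul]
    simpa using dvd_add h2 h3

/-- Each step of the recursion divides by `ϖ` once, so the denominator of `ℓ_k` is at most `ϖ ^ k`.
-/
theorem exists_ϖ_pow_mul_logCoeff (k : ℕ) :
    ∃ c : V, D.ι (D.ϖ ^ k) * D.logCoeff v k = D.ι c := by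
  induction k using Nat.strong_induction_on with
  | _ k ih =>
  rcases k with _ | n
  · exact ⟨1, by rw [logCoeff_zero, pow_zero, mul_one]⟩
  choose! c hc using ih
  refine ⟨∑ i ∈ Finset.range (n + 1), v (i + 1) * (D.ϖ ^ i * (D.σ ^ (i + 1)) (c (n - i))), ?_⟩
  rw [pow_succ, map_mul, mul_assoc, D.ϖ_mul_logCoeff_succ, Finset.mul_sum, map_sum]
  refine Finset.sum_congr rfl fun i hi => ?_
  rw [Finset.mem_range] at hi
  rw [map_mul, map_mul, ← D.σP_pow_ι, ← hc (n - i) (by omega), map_mul, D.σP_pow_ι, map_pow (D.σ ^ _),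
    D.σ_pow_ϖ, mul_left_comm, ← mul_assoc (D.ι (D.ϖ ^ i)), ← map_mul, ← pow_add,
    Nat.add_sub_cancel' (by omega : i ≤ n)]

theorem exists_ϖ_pow_mul_σP_pow_logCoeff (i k : ℕ) :
    ∃ c : V, D.ι (D.ϖ ^ k) * (D.σP ^ i) (D.logCoeff v k) = D.ι c := by
  obtain ⟨c, hc⟩ := D.exists_ϖ_pow_mul_logCoeff v k
  refine ⟨(D.σ ^ i) c, ?_⟩
  rw [← D.σP_pow_ι, ← hc, map_mul, D.σP_pow_ι, map_pow (D.σ ^ _), D.σ_pow_ϖ]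

/-- The series `f^{σ^i}` preserves congruences modulo `ϖ`. -/
theorem exists_subst_map_log_sub_eq (i : ℕ) {a b : MvPowerSeries τ V}
    (ha : MvPowerSeries.constantCoeff a = 0) (hb : MvPowerSeries.constantCoeff b = 0)
    (hab : MvPowerSeries.C D.ϖ ∣ a - b) :
    ∃ c : MvPowerSeries τ V,
      PowerSeries.subst (MvPowerSeries.map D.ι a) (PowerSeries.map (D.σP ^ i) (D.log v)) -
        PowerSeries.subst (MvPowerSeries.map D.ι b) (PowerSeries.map (D.σP ^ i) (D.log v)) =
      MvPowerSeries.C (D.ι D.ϖ) * MvPowerSeries.map D.ι c := by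
  suffices h : ∀ d, ∃ c : V, MvPowerSeries.coeff d
      (PowerSeries.subst (MvPowerSeries.map D.ι a) (PowerSeries.map (D.σP ^ i) (D.log v)) -
        PowerSeries.subst (MvPowerSeries.map D.ι b) (PowerSeries.map (D.σP ^ i) (D.log v))) =
      D.ι D.ϖ * D.ι c by
    choose c hc using h
    obtain ⟨y, hy⟩ := MvPowerSeries.exists_forall_coeff_eq c
    refine ⟨y, ?_⟩
    ext d
    rw [hc, MvPowerSeries.coeff_C_mul, MvPowerSeries.coeff_map, hy]
  intro d
  have hs : ∀ x : MvPowerSeries τ V, MvPowerSeries.constantCoeff x = 0 →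
      PowerSeries.HasSubst (MvPowerSeries.map D.ι x) := fun x hx =>
    PowerSeries.HasSubst.of_constantCoeff_zero (by
      rw [MvPowerSeries.constantCoeff_map, hx, map_zero])
  rw [map_sub, PowerSeries.coeff_subst (hs a ha), PowerSeries.coeff_subst (hs b hb),
    ← finsum_sub_distrib (PowerSeries.coeff_subst_finite (hs a ha) _ d)
      (PowerSeries.coeff_subst_finite (hs b hb) _ d)]
  refine finsum_induction (p := fun z => ∃ c : V, z = D.ι D.ϖ * D.ι c) ⟨0, by simp⟩ ?_ ?_
  · rintro _ _ ⟨x, rfl⟩ ⟨y, rfl⟩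
    exact ⟨x + y, by rw [map_add, mul_add]⟩
  · intro m
    rw [smul_eq_mul, smul_eq_mul, ← mul_sub, ← map_sub, ← map_pow, ← map_pow, ← map_sub,
      MvPowerSeries.coeff_map, log, map_typicalSeries]
    by_cases hm : ∃ k, m = (p ^ r) ^ k
    · obtain ⟨k, rfl⟩ := hm
      rw [coeff_typicalSeries_pow _ D.one_lt_q]
      have hp : MvPowerSeries.C D.ϖ ∣ ((p : ℕ) : MvPowerSeries τ V) := by
        rw [← map_natCast MvPowerSeries.C]
        exact map_dvd _ D.ϖ_dvd_p
      -- The congruence between the `q ^ k`-th powers improves to one modulo `ϖ ^ (r k + 1)`. As `r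
      -- ≥ 1`, this beats the denominator `ϖ ^ k` of `ℓ_k` by a factor `ϖ`.
      have h1 := pow_succ_dvd_pow_pow_sub_pow_pow hp hab (r * k)
      rw [pow_mul] at h1
      have h2 : MvPowerSeries.C D.ϖ ^ (k + 1) ∣ a ^ (p ^ r) ^ k - b ^ (p ^ r) ^ k :=
        (pow_dvd_pow _ (Nat.succ_le_succ
          (Nat.le_mul_of_pos_left k (Nat.pos_of_ne_zero D.r_ne_zero)))).trans h1
      obtain ⟨e, he⟩ := h2
      obtain ⟨c, hc⟩ := D.exists_ϖ_pow_mul_σP_pow_logCoeff v i k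
      refine ⟨c * MvPowerSeries.coeff d e, ?_⟩
      rw [he, ← map_pow, MvPowerSeries.coeff_C_mul, map_mul, map_mul D.ι c, ← hc, pow_succ,
        map_mul]
      ring
    · push Not at hm
      exact ⟨0, by rw [coeff_typicalSeries_of_ne _ hm, zero_mul, map_zero, mul_zero]⟩

/-- `h` satisfies the same functional equation as the logarithm, with an integral error term. -/
def SatisfiesFunctionalEquation (h : MvPowerSeries τ P) : Prop :=
  ∃ w : MvPowerSeries τ V, ∀ N, MvPowerSeries.C (D.ι D.ϖ) * (h - MvPowerSeries.map D.ι w) -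
    ∑ i ∈ Finset.range N, MvPowerSeries.C (D.ι (v (i + 1))) * D.frobP (i + 1) h ∈ orderIdeal τ P N

variable {v}

theorem satisfiesFunctionalEquation_subst_X (s : τ) :
    D.SatisfiesFunctionalEquation v
      (PowerSeries.subst (MvPowerSeries.X s : MvPowerSeries τ P) (D.log v)) := by
  refine ⟨MvPowerSeries.X s, fun N => ?_⟩
  have h := D.subst_log_functionalEquation v (MvPowerSeries.constantCoeff_X s) N
  simpa only [MvPowerSeries.map_X, D.frobP_subst _ (MvPowerSeries.constantCoeff_X s),
    D.frobP_X] using h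

theorem SatisfiesFunctionalEquation.add {h h' : MvPowerSeries τ P}
    (H : D.SatisfiesFunctionalEquation v h) (H' : D.SatisfiesFunctionalEquation v h') :
    D.SatisfiesFunctionalEquation v (h + h') := by
  obtain ⟨w, hw⟩ := H
  obtain ⟨w', hw'⟩ := H'
  refine ⟨w + w', fun N => ?_⟩
  have := add_mem (hw N) (hw' N)
  simp only [D.frobP_add, mul_add, Finset.sum_add_distrib, map_add]
  convert this using 1
  ring

theorem SatisfiesFunctionalEquation.C_mul {h : MvPowerSeries τ P}
    (H : D.SatisfiesFunctionalEquation v h) {a : V} (ha : D.σ a = a) :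
    D.SatisfiesFunctionalEquation v (MvPowerSeries.C (D.ι a) * h) := by
  obtain ⟨w, hw⟩ := H
  have ha' : ∀ i, (D.σ ^ i) a = a := fun i => by
    induction i with
    | zero => rfl
    | succ i ih => rw [pow_succ, RingHom.mul_def, RingHom.comp_apply, ha, ih]
  refine ⟨MvPowerSeries.C a * w, fun N => ?_⟩
  have := Ideal.mul_mem_left _ (MvPowerSeries.C (D.ι a)) (hw N)
  simp only [D.frobP_C_mul, D.σP_pow_ι, ha', map_mul, MvPowerSeries.map_C]
  simp only [mul_sub, Finset.mul_sum] at this ⊢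
  simpa only [mul_left_comm (MvPowerSeries.C (D.ι a))] using this

/-- Subtracting the functional equations of `h` and of `f` at `u` expresses `ϖ (u - e)`, with `e`
the integral error term of `h`, through the differences of `f^{σ^i}` at `u^{σ^i}(T ^ (q ^ i))` and
at `u ^ (q ^ i)`. Since `i ≥ 1`, replacing `u` by its approximation `w` in these terms changes
nothing up to degree `N`. For the integral series `w` the two arguments agree modulo `ϖ`, so the
differences are divisible by `ϖ`, and dividing gives the next approximation. -/
theorem exists_map_eq_of_subst_log_aux {u h : MvPowerSeries τ P}
    (hu : MvPowerSeries.constantCoeff u = 0) (huh : PowerSeries.subst u (D.log v) = h)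
    (H : D.SatisfiesFunctionalEquation v h) {N : ℕ} (hN : N ≠ 0) {w : MvPowerSeries τ V}
    (hw0 : MvPowerSeries.constantCoeff w = 0)
    (hw : u - MvPowerSeries.map D.ι w ∈ orderIdeal τ P N) :
    ∃ w' : MvPowerSeries τ V, u - MvPowerSeries.map D.ι w' ∈ orderIdeal τ P (N + 1) := by
  obtain ⟨e, he⟩ := H
  have hιw : MvPowerSeries.constantCoeff (MvPowerSeries.map D.ι w) = 0 := by
    rw [MvPowerSeries.constantCoeff_map, hw0, map_zero]
  have hpow : ∀ (y : MvPowerSeries τ V) i, MvPowerSeries.constantCoeff y = 0 →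
      MvPowerSeries.constantCoeff (y ^ (p ^ r) ^ i) = 0 := fun y i hy => by
    rw [map_pow, hy, zero_pow (pow_ne_zero i D.q_ne_zero)]
  have hpowP : ∀ (y : MvPowerSeries τ P) i, MvPowerSeries.constantCoeff y = 0 →
      MvPowerSeries.constantCoeff (y ^ (p ^ r) ^ i) = 0 := fun y i hy => by
    rw [map_pow, hy, zero_pow (pow_ne_zero i D.q_ne_zero)]
  choose c hc using fun i => D.exists_subst_map_log_sub_eq v (i + 1)
    (D.constantCoeff_frobV (i + 1) hw0) (hpow w (i + 1) hw0) (D.C_ϖ_dvd_frobV_sub_pow (i + 1) w)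
  have h1 : ∀ i, D.frobP (i + 1) h - PowerSeries.subst (MvPowerSeries.map D.ι (D.frobV (i + 1) w))
      (PowerSeries.map (D.σP ^ (i + 1)) (D.log v)) ∈ orderIdeal τ P (N + 1) := fun i => by
    rw [← huh, D.frobP_subst _ hu, ← D.frobP_map_ι]
    refine PowerSeries.subst_sub_subst_mem_orderIdeal (D.constantCoeff_frobP _ hu)
      (D.constantCoeff_frobP _ hιw) _ ?_
    rw [← D.frobP_sub]
    exact D.frobP_mem_orderIdeal i.succ_ne_zero hN hw
  have h2 : ∀ i, PowerSeries.subst (u ^ (p ^ r) ^ (i + 1))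
        (PowerSeries.map (D.σP ^ (i + 1)) (D.log v)) -
      PowerSeries.subst (MvPowerSeries.map D.ι (w ^ (p ^ r) ^ (i + 1)))
        (PowerSeries.map (D.σP ^ (i + 1)) (D.log v)) ∈ orderIdeal τ P (N + 1) := fun i => by
    rw [map_pow]
    refine PowerSeries.subst_sub_subst_mem_orderIdeal (hpowP _ _ hu) (hpowP _ _ hιw) _ ?_
    exact MvPowerSeries.sub_pow_mem_orderIdeal_succ hu hιw hw
      (Nat.one_lt_pow i.succ_ne_zero D.one_lt_q)
  have h3 := D.subst_log_functionalEquation v hu (N + 1)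
  have h4 := he (N + 1)
  rw [huh] at h3
  -- The `c i` are the differences of the two kinds of term for `w`, divided by `ϖ`.
  refine ⟨e + ∑ i ∈ Finset.range (N + 1), MvPowerSeries.C (v (i + 1)) * c i, ?_⟩
  have h5 : MvPowerSeries.C (D.ι D.ϖ) * (u - MvPowerSeries.map D.ι
      (e + ∑ i ∈ Finset.range (N + 1), MvPowerSeries.C (v (i + 1)) * c i)) ∈
      orderIdeal τ P (N + 1) := by
    have h6 := Submodule.sum_mem (orderIdeal τ P (N + 1)) (t := Finset.range (N + 1)) fun i _ => Ideal.mul_mem_left _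
      (MvPowerSeries.C (D.ι (v (i + 1)))) (sub_mem (h1 i) (h2 i))
    have h7 := add_mem (sub_mem h4 h3) h6
    convert h7 using 1
    have h8 : MvPowerSeries.C (D.ι D.ϖ) * MvPowerSeries.map D.ι
        (∑ i ∈ Finset.range (N + 1), MvPowerSeries.C (v (i + 1)) * c i) =
        ∑ i ∈ Finset.range (N + 1), MvPowerSeries.C (D.ι (v (i + 1))) *
          (PowerSeries.subst (MvPowerSeries.map D.ι (D.frobV (i + 1) w))
            (PowerSeries.map (D.σP ^ (i + 1)) (D.log v)) -
          PowerSeries.subst (MvPowerSeries.map D.ι (w ^ (p ^ r) ^ (i + 1)))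
            (PowerSeries.map (D.σP ^ (i + 1)) (D.log v))) := by
      rw [map_sum, Finset.mul_sum]
      refine Finset.sum_congr rfl fun i _ => ?_
      rw [hc, map_mul, MvPowerSeries.map_C]
      ring
    rw [map_add, mul_sub, mul_add, h8]
    simp only [mul_sub, Finset.sum_sub_distrib]
    ring
  have h9 := Ideal.mul_mem_left _ (MvPowerSeries.C D.invϖ) h5
  rwa [← mul_assoc, ← map_mul, mul_comm D.invϖ, D.ι_mul_invϖ, map_one, one_mul] at h9

/-- The functional equation lemma: if `h` satisfies the functional equation with an integral error
term, then `f⁻¹(h)` is integral. -/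
theorem exists_subst_log_eq {h : MvPowerSeries τ P} (hh : MvPowerSeries.constantCoeff h = 0)
    (H : D.SatisfiesFunctionalEquation v h) :
    ∃ w : MvPowerSeries τ V, MvPowerSeries.constantCoeff w = 0 ∧
      PowerSeries.subst (MvPowerSeries.map D.ι w) (D.log v) = h := by
  obtain ⟨u, hu, huh⟩ := PowerSeries.exists_subst_eq (D.constantCoeff_log v) (D.coeff_one_log v) hh
  have key : ∀ N, ∃ w : MvPowerSeries τ V,
      u - MvPowerSeries.map D.ι w ∈ orderIdeal τ P (N + 1) := by
    intro N
    induction N with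
    | zero => exact ⟨0, by rw [map_zero, sub_zero]; exact MvPowerSeries.mem_orderIdeal_one.2 hu⟩
    | succ N ih =>
      obtain ⟨w, hw⟩ := ih
      refine D.exists_map_eq_of_subst_log_aux hu huh H N.succ_ne_zero (w := w) ?_ hw
      have := MvPowerSeries.mem_orderIdeal_one.1 (MvPowerSeries.orderIdeal_antitone
        (Nat.succ_le_succ N.zero_le) hw)
      rw [map_sub, hu, zero_sub, neg_eq_zero, MvPowerSeries.constantCoeff_map] at this
      exact D.ι_injective (this.trans (map_zero _).symm)
  choose w hw using key
  -- `w N` agrees with `u` through degree `N`, so coefficients of degree `N` are read off from `w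
  -- N`.
  obtain ⟨y, hy⟩ := MvPowerSeries.exists_forall_coeff_eq fun d : τ →₀ ℕ =>
    MvPowerSeries.coeff d (w d.degree)
  have hw' : MvPowerSeries.map D.ι y = u := by
    ext d
    have := MvPowerSeries.mem_orderIdeal_iff_coeff.1 (hw d.degree) d (Nat.lt_succ_self _)
    rw [map_sub, sub_eq_zero, MvPowerSeries.coeff_map] at this
    rw [this, MvPowerSeries.coeff_map, hy]
  refine ⟨y, ?_, hw'.symm ▸ huh⟩
  refine D.ι_injective ?_
  rw [← MvPowerSeries.constantCoeff_map, hw', hu, map_zero]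

end FrobeniusLift

/-! ### Formal modules and logarithms -/

theorem MvPowerSeries.subst_powerSeriesSubst {σ τ R : Type*} [CommRing R]
    {a : MvPowerSeries σ R} {b : σ → MvPowerSeries τ R} (ha : MvPowerSeries.constantCoeff a = 0)
    (hb : MvPowerSeries.HasSubst b) (f : PowerSeries R) :
    MvPowerSeries.subst b (PowerSeries.subst a f) =
      PowerSeries.subst (MvPowerSeries.subst b a) f :=
  MvPowerSeries.subst_comp_subst_apply (PowerSeries.HasSubst.of_constantCoeff_zero ha).const hb f

theorem MvPowerSeries.hasSubst_pair {τ R : Type*} [CommRing R] {x y : MvPowerSeries τ R}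
    (hx : MvPowerSeries.constantCoeff x = 0) (hy : MvPowerSeries.constantCoeff y = 0) :
    MvPowerSeries.HasSubst ![x, y] :=
  MvPowerSeries.hasSubst_of_constantCoeff_zero fun i => by fin_cases i <;> assumption

theorem MvPowerSeries.constantCoeff_subst_pair {τ R : Type*} [CommRing R]
    {x y : MvPowerSeries τ R} (hx : MvPowerSeries.constantCoeff x = 0)
    (hy : MvPowerSeries.constantCoeff y = 0) {F : MvPowerSeries (Fin 2) R}
    (hF : MvPowerSeries.constantCoeff F = 0) :
    MvPowerSeries.constantCoeff (MvPowerSeries.subst ![x, y] F) = 0 :=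
  MvPowerSeries.constantCoeff_subst_eq_zero (MvPowerSeries.hasSubst_pair hx hy)
    (fun i => by fin_cases i <;> assumption) hF

/-! ### Additive series in characteristic zero. -/

section AdditiveSeries

variable {P τ : Type*} [CommRing P] {F : MvPowerSeries (Fin 2) P}

/-- `f(F(X, Y)) = f(X) + f(Y)`. -/
def PowerSeries.IsAdditiveFor (f : PowerSeries P) (F : MvPowerSeries (Fin 2) P) : Prop :=
  PowerSeries.subst F f = PowerSeries.subst (MvPowerSeries.X 0 : MvPowerSeries (Fin 2) P) f +
    PowerSeries.subst (MvPowerSeries.X 1 : MvPowerSeries (Fin 2) P) f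

theorem PowerSeries.IsAdditiveFor.subst_subst {f : PowerSeries P} (hf : f.IsAdditiveFor F)
    (hF : MvPowerSeries.constantCoeff F = 0) {x y : MvPowerSeries τ P}
    (hx : MvPowerSeries.constantCoeff x = 0) (hy : MvPowerSeries.constantCoeff y = 0) :
    PowerSeries.subst (MvPowerSeries.subst ![x, y] F) f =
      PowerSeries.subst x f + PowerSeries.subst y f := by
  have hxy := MvPowerSeries.hasSubst_pair hx hy
  rw [← MvPowerSeries.subst_powerSeriesSubst hF hxy, hf, MvPowerSeries.subst_add hxy,
    MvPowerSeries.subst_powerSeriesSubst (MvPowerSeries.constantCoeff_X _) hxy,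
    MvPowerSeries.subst_powerSeriesSubst (MvPowerSeries.constantCoeff_X _) hxy,
    MvPowerSeries.subst_X hxy, MvPowerSeries.subst_X hxy]
  rfl

/-- The coefficient of `X ^ (n - 1) Y` in `k(X + Y)` is `n k_n`, while `k(X) + k(Y)` has no mixed
terms; `n` is invertible. -/
theorem PowerSeries.eq_C_mul_X_of_subst_add [Algebra ℚ P] {k : PowerSeries P}
    (hk : k.IsAdditiveFor (MvPowerSeries.X 0 + MvPowerSeries.X 1)) :
    k = PowerSeries.C (PowerSeries.coeff 1 k) * PowerSeries.X := by
  have hq : ∀ (n : ℕ) (x : P), ((n + 1 : ℕ) : P) * x = 0 → x = 0 := fun n x hx => by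
    have h1 : algebraMap ℚ P ((n + 1 : ℕ) : ℚ)⁻¹ * ((n + 1 : ℕ) : P) = 1 := by
      rw [← map_natCast (algebraMap ℚ P), ← map_mul,
        inv_mul_cancel₀ (Nat.cast_ne_zero.2 n.succ_ne_zero), map_one]
    rw [← one_mul x, ← h1, mul_assoc, hx, mul_zero]
  ext n
  rw [PowerSeries.coeff_C_mul, PowerSeries.coeff_X]
  have h := congrArg (MvPowerSeries.coeff (Finsupp.single 0 (n - 1) + Finsupp.single 1 1)) hk
  rw [PowerSeries.coeff_subst_X_zero_add_X_one, map_add, PowerSeries.coeff_subst_single,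
    PowerSeries.coeff_subst_single] at h
  obtain rfl | rfl | ⟨m, rfl⟩ : n = 0 ∨ n = 1 ∨ ∃ m, n = m + 2 := by
    rcases n with _ | _ | m
    · exact Or.inl rfl
    · exact Or.inr (Or.inl rfl)
    · exact Or.inr (Or.inr ⟨m, rfl⟩)
  -- For `n = 0` the constant terms give `k_0 = k_0 + k_0`.
  · have h0 := congrArg (MvPowerSeries.coeff 0) hk
    rw [PowerSeries.coeff_subst_X_zero_add_X_one, map_add, PowerSeries.coeff_subst_single,
      PowerSeries.coeff_subst_single] at h0
    simpa using h0
  · simp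
  · have e0 : (Finsupp.single (0 : Fin 2) (m + 1) + Finsupp.single 1 1 : Fin 2 →₀ ℕ) 0 = m + 1 := by
      simp
    have e1 : (Finsupp.single (0 : Fin 2) (m + 1) + Finsupp.single 1 1 : Fin 2 →₀ ℕ) 1 = 1 := by
      simp
    rw [show m + 2 - 1 = m + 1 from rfl, e0, e1, if_neg, if_neg, add_zero,
      Nat.choose_succ_self_right] at h
    · rw [if_neg (by omega), mul_zero]
      exact hq _ _ h
    · intro h'
      have := DFunLike.congr_fun h' 0
      simp at this
    · intro h'
      have := DFunLike.congr_fun h' 1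
      simp at this

/-- The logarithm spans the additive series. -/
theorem PowerSeries.IsAdditiveFor.eq_C_mul [Algebra ℚ P] {f h : PowerSeries P}
    (hF : MvPowerSeries.constantCoeff F = 0)
    (hf0 : PowerSeries.constantCoeff f = 0) (hf1 : PowerSeries.coeff 1 f = 1)
    (hf : f.IsAdditiveFor F) (hh : h.IsAdditiveFor F) :
    h = PowerSeries.C (PowerSeries.coeff 1 h) * f := by
  obtain ⟨g, hg0, hg1, hfg, hgf⟩ := PowerSeries.exists_subst_inverse hf0 hf1
  have hgX : ∀ i : Fin 2, MvPowerSeries.constantCoeff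
      (PowerSeries.subst (MvPowerSeries.X i : MvPowerSeries (Fin 2) P) g) = 0 := fun i =>
    PowerSeries.constantCoeff_subst_eq_zero (MvPowerSeries.constantCoeff_X i) g hg0
  have hs : MvPowerSeries.constantCoeff
      (MvPowerSeries.X 0 + MvPowerSeries.X 1 : MvPowerSeries (Fin 2) P) = 0 := by simp
  have comp : ∀ {z : MvPowerSeries (Fin 2) P} (_ : MvPowerSeries.constantCoeff z = 0)
      (k : PowerSeries P), PowerSeries.subst (PowerSeries.subst z g) k =
        PowerSeries.subst z (PowerSeries.subst g k : PowerSeries P) := fun hz k =>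
    (PowerSeries.subst_comp_subst_apply (PowerSeries.HasSubst.of_constantCoeff_zero' hg0)
      (PowerSeries.HasSubst.of_constantCoeff_zero hz) k).symm
  -- The inverse `g` of `f` carries ordinary addition to `F`; thus `h ∘ g` is additive in the
  -- ordinary sense, hence linear.
  have hlaw : MvPowerSeries.subst ![PowerSeries.subst (MvPowerSeries.X 0) g,
      PowerSeries.subst (MvPowerSeries.X 1) g] F =
      PowerSeries.subst (MvPowerSeries.X 0 + MvPowerSeries.X 1 : MvPowerSeries (Fin 2) P) g := by
    refine PowerSeries.subst_left_injective hf0 hf1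
      (MvPowerSeries.constantCoeff_subst_pair (hgX 0) (hgX 1) hF)
      (PowerSeries.constantCoeff_subst_eq_zero hs g hg0) ?_
    rw [hf.subst_subst hF (hgX 0) (hgX 1), comp (MvPowerSeries.constantCoeff_X _),
      comp (MvPowerSeries.constantCoeff_X _), comp hs, hfg,
      PowerSeries.subst_X (PowerSeries.HasSubst.X 0), PowerSeries.subst_X (PowerSeries.HasSubst.X 1),
      PowerSeries.subst_X (PowerSeries.HasSubst.of_constantCoeff_zero hs)]
  have hk : PowerSeries.IsAdditiveFor (PowerSeries.subst g h : PowerSeries P)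
      (MvPowerSeries.X 0 + MvPowerSeries.X 1) := by
    rw [PowerSeries.IsAdditiveFor, ← comp hs, ← comp (MvPowerSeries.constantCoeff_X _),
      ← comp (MvPowerSeries.constantCoeff_X _), ← hlaw, hh.subst_subst hF (hgX 0) (hgX 1)]
  have hf0' := PowerSeries.HasSubst.of_constantCoeff_zero' hf0
  have h1 := congrArg (fun k : PowerSeries P => (PowerSeries.subst f k : PowerSeries P))
    (PowerSeries.eq_C_mul_X_of_subst_add hk)
  simp only [PowerSeries.subst_comp_subst_apply (PowerSeries.HasSubst.of_constantCoeff_zero' hg0)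
    hf0', hgf, PowerSeries.X_subst, PowerSeries.subst_mul hf0', PowerSeries.subst_X hf0'] at h1
  have h2 : ∀ c : P, (PowerSeries.subst f (PowerSeries.C c) : PowerSeries P) = PowerSeries.C c :=
    fun c => PowerSeries.subst_C c
  rw [h2] at h1
  have h3 := congrArg (PowerSeries.coeff 1) h1
  rw [PowerSeries.coeff_C_mul, hf1, mul_one] at h3
  rwa [← h3] at h1

end AdditiveSeries

namespace FormalModule

/-! ### Formal modules constructed from a logarithm. -/

section OfLog

variable {A S P τ : Type*} [CommRing A] [CommRing S] [CommRing P] [Algebra A S] {ι : S →+* P}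
  {f : PowerSeries P} {F : MvPowerSeries (Fin 2) S}

theorem constantCoeff_map_eq_zero (ι : S →+* P) {x : MvPowerSeries τ S}
    (hx : MvPowerSeries.constantCoeff x = 0) :
    MvPowerSeries.constantCoeff (MvPowerSeries.map ι x) = 0 := by
  rw [MvPowerSeries.constantCoeff_map, hx, map_zero]

/-- This reduces the axioms of a formal module to arithmetic: after applying `f`, the formal group
law becomes addition and `[a]` becomes multiplication by `a`. -/
theorem eq_of_subst_map_eq (hι : Function.Injective ι) (hf0 : PowerSeries.constantCoeff f = 0)
    (hf1 : PowerSeries.coeff 1 f = 1) {x y : MvPowerSeries τ S}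
    (hx : MvPowerSeries.constantCoeff x = 0) (hy : MvPowerSeries.constantCoeff y = 0)
    (h : PowerSeries.subst (MvPowerSeries.map ι x) f =
      PowerSeries.subst (MvPowerSeries.map ι y) f) : x = y := by
  have h1 := PowerSeries.subst_left_injective hf0 hf1 (constantCoeff_map_eq_zero ι hx)
    (constantCoeff_map_eq_zero ι hy) h
  ext d
  have := congrArg (MvPowerSeries.coeff d) h1
  rw [MvPowerSeries.coeff_map, MvPowerSeries.coeff_map] at this
  exact hι this

theorem subst_map_subst_law (hF0 : MvPowerSeries.constantCoeff F = 0)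
    (hF : f.IsAdditiveFor (MvPowerSeries.map ι F)) {x y : MvPowerSeries τ S}
    (hx : MvPowerSeries.constantCoeff x = 0) (hy : MvPowerSeries.constantCoeff y = 0) :
    PowerSeries.subst (MvPowerSeries.map ι (MvPowerSeries.subst ![x, y] F)) f =
      PowerSeries.subst (MvPowerSeries.map ι x) f + PowerSeries.subst (MvPowerSeries.map ι y) f := by
  rw [MvPowerSeries.map_subst (MvPowerSeries.hasSubst_pair hx hy),
    ← hF.subst_subst (constantCoeff_map_eq_zero ι hF0) (constantCoeff_map_eq_zero ι hx)
      (constantCoeff_map_eq_zero ι hy)]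
  congr 2
  funext i
  fin_cases i <;> rfl

theorem subst_map_subst_act {b : PowerSeries S} {c : P}
    (hb0 : PowerSeries.constantCoeff b = 0)
    (hb : (PowerSeries.subst (PowerSeries.map ι b) f : PowerSeries P) = PowerSeries.C c * f)
    {x : MvPowerSeries τ S} (hx : MvPowerSeries.constantCoeff x = 0) :
    PowerSeries.subst (MvPowerSeries.map ι (PowerSeries.subst x b)) f =
      MvPowerSeries.C c * PowerSeries.subst (MvPowerSeries.map ι x) f := by
  have hx' := PowerSeries.HasSubst.of_constantCoeff_zero (constantCoeff_map_eq_zero ι hx)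
  have hC : PowerSeries.subst (MvPowerSeries.map ι x) (PowerSeries.C c) = MvPowerSeries.C c :=
    PowerSeries.subst_C c
  rw [PowerSeries.map_subst (PowerSeries.HasSubst.of_constantCoeff_zero hx),
    ← PowerSeries.subst_comp_subst_apply (PowerSeries.HasSubst.of_constantCoeff_zero' ?_) hx', hb,
    PowerSeries.subst_mul hx', hC]
  exact constantCoeff_map_eq_zero ι hb0

/-- The formal `A`-module with logarithm `f`, assuming that the series `f⁻¹(f(X) + f(Y))` and
`f⁻¹(a f(X))` are integral. -/
def ofLog (hι : Function.Injective ι) (hf0 : PowerSeries.constantCoeff f = 0)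
    (hf1 : PowerSeries.coeff 1 f = 1) (hF0 : MvPowerSeries.constantCoeff F = 0)
    (hF : f.IsAdditiveFor (MvPowerSeries.map ι F)) {act : A → PowerSeries S}
    (hact0 : ∀ a, PowerSeries.constantCoeff (act a) = 0)
    (hact : ∀ a, (PowerSeries.subst (PowerSeries.map ι (act a)) f : PowerSeries P) =
      PowerSeries.C (ι (algebraMap A S a)) * f) : FormalModule A S :=
  -- Modulo degree two `f` is the identity, so `f(F) = f(X) + f(Y)` forces `F ≡ X + Y`.
  have hF1 : ∀ i : Fin 2, MvPowerSeries.coeff (Finsupp.single i 1) F = 1 := fun i => by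
    have h1 := PowerSeries.subst_sub_self_mem_orderIdeal_two (constantCoeff_map_eq_zero ι hF0)
      hf0 hf1
    rw [hF] at h1
    have h2 := fun j : Fin 2 => PowerSeries.subst_sub_self_mem_orderIdeal_two
      (MvPowerSeries.constantCoeff_X (R := P) j) hf0 hf1
    have h3 := MvPowerSeries.mem_orderIdeal_iff_coeff.1 (sub_mem h1 (add_mem (h2 0) (h2 1)))
      (Finsupp.single i 1) (by simp)
    simp only [map_sub, map_add, MvPowerSeries.coeff_map] at h3
    refine hι ?_
    rw [map_one]
    have h4 : MvPowerSeries.coeff (Finsupp.single i 1) (MvPowerSeries.X 0 : MvPowerSeries (Fin 2) P) +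
        MvPowerSeries.coeff (Finsupp.single i 1) (MvPowerSeries.X 1 : MvPowerSeries (Fin 2) P) =
          1 := by
      fin_cases i <;> simp [MvPowerSeries.coeff_index_single_X]
    linear_combination -h3 + h4
  have hX : ∀ {n : ℕ} (i : Fin n),
      MvPowerSeries.constantCoeff (MvPowerSeries.X i : MvPowerSeries (Fin n) S) = 0 :=
    fun i => MvPowerSeries.constantCoeff_X i
  have hlaw := fun {τ : Type} {x y : MvPowerSeries τ S} (hx : MvPowerSeries.constantCoeff x = 0)
    (hy : MvPowerSeries.constantCoeff y = 0) => subst_map_subst_law hF0 hF hx hy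
  have hlaw0 := fun {τ : Type} {x y : MvPowerSeries τ S} (hx : MvPowerSeries.constantCoeff x = 0)
    (hy : MvPowerSeries.constantCoeff y = 0) =>
      MvPowerSeries.constantCoeff_subst_pair (F := F) hx hy hF0
  have hsub := fun {τ : Type} {x : MvPowerSeries τ S} (a : A)
    (hx : MvPowerSeries.constantCoeff x = 0) => subst_map_subst_act (hact0 a) (hact a) hx
  have hsub0 := fun {τ : Type} {x : MvPowerSeries τ S} (a : A)
    (hx : MvPowerSeries.constantCoeff x = 0) =>
      PowerSeries.constantCoeff_subst_eq_zero hx (act a) (hact0 a)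
  { law :=
      { toPowerSeries := F
        zero_constantCoeff := hF0
        lin_coeff_X := hF1 0
        lin_coeff_Y := hF1 1
        assoc := eq_of_subst_map_eq hι hf0 hf1 (hlaw0 (hlaw0 (hX 0) (hX 1)) (hX 2))
          (hlaw0 (hX 0) (hlaw0 (hX 1) (hX 2))) <| by
            rw [hlaw (hlaw0 (hX 0) (hX 1)) (hX 2), hlaw (hX 0) (hlaw0 (hX 1) (hX 2)),
              hlaw (hX 0) (hX 1), hlaw (hX 1) (hX 2), add_assoc] }
    law_comm := ⟨eq_of_subst_map_eq hι hf0 hf1 hF0 (hlaw0 (hX 1) (hX 0)) <| hF.trans <| by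
      rw [hlaw (hX 1) (hX 0), MvPowerSeries.map_X, MvPowerSeries.map_X, add_comm]⟩
    act := act
    act_constantCoeff := hact0
    act_coeff_one := fun a => hι <| by
      have h1 := PowerSeries.subst_sub_self_mem_orderIdeal_two
        (constantCoeff_map_eq_zero ι (hact0 a)) hf0 hf1
      have h2 := MvPowerSeries.mem_orderIdeal_iff_coeff.1 h1 (Finsupp.single () 1) (by simp)
      have h3 : PowerSeries.coeff 1 ((PowerSeries.subst (PowerSeries.map ι (act a)) f :
        PowerSeries P) - PowerSeries.map ι (act a)) = 0 := h2
      rw [hact, map_sub, PowerSeries.coeff_C_mul, hf1, mul_one, PowerSeries.coeff_map] at h3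
      exact (sub_eq_zero.1 h3).symm
    act_hom := fun a => eq_of_subst_map_eq hι hf0 hf1 (hsub0 a hF0)
      (hlaw0 (hsub0 a (hX 0)) (hsub0 a (hX 1))) <| by
        rw [hsub a hF0, hlaw (hsub0 a (hX 0)) (hsub0 a (hX 1)), hsub a (hX 0), hsub a (hX 1), hF,
          mul_add, MvPowerSeries.map_X, MvPowerSeries.map_X]
    act_add := fun a b => eq_of_subst_map_eq hι hf0 hf1 (hact0 _)
      (hlaw0 (hact0 a) (hact0 b)) <| by
        rw [hlaw (hact0 a) (hact0 b)]
        refine (hact _).trans (Eq.trans ?_ (congrArg₂ (· + ·) (hact a) (hact b)).symm)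
        rw [map_add, map_add, map_add, add_mul]
    act_mul := fun a b => eq_of_subst_map_eq hι hf0 hf1 (hact0 _) (hsub0 a (hact0 b)) <| by
        rw [hsub a (hact0 b)]
        refine (hact _).trans (Eq.trans ?_ (congrArg (MvPowerSeries.C _ * ·) (hact b)).symm)
        rw [map_mul, map_mul, map_mul, mul_assoc]
        rfl
    act_one := eq_of_subst_map_eq hι hf0 hf1 (hact0 _) PowerSeries.constantCoeff_X <| by
        refine (hact _).trans (Eq.trans ?_ (congrArg (fun z : PowerSeries P =>
          (PowerSeries.subst z f : PowerSeries P)) (PowerSeries.map_X (f := ι))).symm)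
        rw [map_one, map_one, map_one, one_mul, PowerSeries.X_subst] }

end OfLog

/-! ### Uniqueness and functoriality of logarithms. -/

section IsLogarithm

variable {A R S : Type*} [CommRing A] [CommRing R] [CommRing S] [Algebra A R] [Algebra A S]

variable (S) in
/-- The ring homomorphism `S → ℚ ⊗ S`. -/
abbrev toRat : S →+* ℚ ⊗[ℤ] S :=
  (Algebra.TensorProduct.includeRight : S →ₐ[ℤ] ℚ ⊗[ℤ] S).toRingHom

variable (S) in
theorem toRat_injective [Module.IsTorsionFree ℤ S] : Function.Injective (toRat S) :=
  Algebra.TensorProduct.includeRight_injective (R := ℤ) (A := ℚ) (B := S)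
    (RingHom.injective_int (algebraMap ℤ ℚ))

variable {F G : FormalModule A S} {f g : PowerSeries (ℚ ⊗[ℤ] S)}

theorem IsLogarithm.isAdditiveFor (hf : F.IsLogarithm f) :
    f.IsAdditiveFor (MvPowerSeries.map (toRat S) F.law.toPowerSeries) :=
  hf.subst_law

theorem IsLogarithm.unique (hf : F.IsLogarithm f) (hg : F.IsLogarithm g) : f = g := by
  have := PowerSeries.IsAdditiveFor.eq_C_mul
    (constantCoeff_map_eq_zero (toRat S) F.law.zero_constantCoeff) hf.constantCoeff_eq
    hf.coeff_one_eq hf.isAdditiveFor hg.isAdditiveFor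
  rw [hg.coeff_one_eq, map_one, one_mul] at this
  exact this.symm

/-- As `[a]` is an endomorphism of `F`, the series `f ∘ [a]` is additive for `F`, hence a multiple
of `f`; its linear term gives the factor. -/
theorem IsLogarithm.subst_act (hf : F.IsLogarithm f) (a : A) :
    (PowerSeries.subst (PowerSeries.map (toRat S) (F.act a)) f : PowerSeries (ℚ ⊗[ℤ] S)) =
      PowerSeries.C (toRat S (algebraMap A S a)) * f := by
  have ha0 : PowerSeries.constantCoeff (PowerSeries.map (toRat S) (F.act a)) = 0 :=
    constantCoeff_map_eq_zero (toRat S) (F.act_constantCoeff a)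
  have hF0 := F.law.zero_constantCoeff
  have hX := fun i : Fin 2 => MvPowerSeries.constantCoeff_X (R := S) i
  have hX0 := fun i : Fin 2 => PowerSeries.constantCoeff_subst_eq_zero (hX i) (F.act a)
    (F.act_constantCoeff a)
  have comp : ∀ {z : MvPowerSeries (Fin 2) S} (_ : MvPowerSeries.constantCoeff z = 0),
      PowerSeries.subst (MvPowerSeries.map (toRat S) z)
        (PowerSeries.subst (PowerSeries.map (toRat S) (F.act a)) f : PowerSeries (ℚ ⊗[ℤ] S)) =
      PowerSeries.subst (MvPowerSeries.map (toRat S) (PowerSeries.subst z (F.act a))) f :=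
    fun {z} hz => by
      rw [PowerSeries.subst_comp_subst_apply (PowerSeries.HasSubst.of_constantCoeff_zero' ha0)
        (PowerSeries.HasSubst.of_constantCoeff_zero (constantCoeff_map_eq_zero _ hz)),
        PowerSeries.map_subst (PowerSeries.HasSubst.of_constantCoeff_zero hz)]
  have hadd : PowerSeries.IsAdditiveFor
      (PowerSeries.subst (PowerSeries.map (toRat S) (F.act a)) f : PowerSeries (ℚ ⊗[ℤ] S))
        (MvPowerSeries.map (toRat S) F.law.toPowerSeries) := by
    rw [PowerSeries.IsAdditiveFor, ← MvPowerSeries.map_X (toRat S), ← MvPowerSeries.map_X (toRat S),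
      comp hF0, comp (hX 0), comp (hX 1), F.act_hom,
      subst_map_subst_law hF0 hf.isAdditiveFor (hX0 0) (hX0 1)]
  have h1 := PowerSeries.subst_sub_self_mem_orderIdeal_two ha0 hf.constantCoeff_eq hf.coeff_one_eq
  have h2 : PowerSeries.coeff 1 ((PowerSeries.subst (PowerSeries.map (toRat S) (F.act a)) f :
      PowerSeries (ℚ ⊗[ℤ] S)) - PowerSeries.map (toRat S) (F.act a)) = 0 :=
    MvPowerSeries.mem_orderIdeal_iff_coeff.1 h1 (Finsupp.single () 1) (by simp)
  rw [map_sub, PowerSeries.coeff_map, F.act_coeff_one, sub_eq_zero] at h2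
  rw [← h2]
  exact PowerSeries.IsAdditiveFor.eq_C_mul (constantCoeff_map_eq_zero (toRat S) hF0)
    hf.constantCoeff_eq hf.coeff_one_eq hf.isAdditiveFor hadd

/-- Over a torsion-free ring, a formal module is determined by its logarithm. -/
theorem IsLogarithm.eq [Module.IsTorsionFree ℤ S] (hF : F.IsLogarithm f) (hG : G.IsLogarithm f) :
    F = G := by
  refine FormalModule.ext (FormalGroup.ext ?_) (funext fun a => ?_)
  · exact eq_of_subst_map_eq (toRat_injective S) hF.constantCoeff_eq hF.coeff_one_eq
      F.law.zero_constantCoeff G.law.zero_constantCoeff (hF.subst_law.trans hG.subst_law.symm)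
  · exact eq_of_subst_map_eq (toRat_injective S) hF.constantCoeff_eq hF.coeff_one_eq
      (F.act_constantCoeff a) (G.act_constantCoeff a)
      ((hF.subst_act a).trans (hG.subst_act a).symm)

/-- The homomorphism `ℚ ⊗ R → ℚ ⊗ S` induced by a homomorphism `R → S`. -/
def mapRat (φ : R →+* S) : ℚ ⊗[ℤ] R →+* ℚ ⊗[ℤ] S :=
  (Algebra.TensorProduct.map (AlgHom.id ℤ ℚ) φ.toIntAlgHom).toRingHom

theorem mapRat_toRat (φ : R →+* S) (x : R) : mapRat φ (toRat R x) = toRat S (φ x) := by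
  simp [mapRat]

theorem IsLogarithm.map {F : FormalModule A R} {f : PowerSeries (ℚ ⊗[ℤ] R)} (hf : F.IsLogarithm f)
    (φ : R →ₐ[A] S) : (F.map φ).IsLogarithm (PowerSeries.map (mapRat (φ : R →+* S)) f) where
  constantCoeff_eq := by
    rw [← PowerSeries.coeff_zero_eq_constantCoeff_apply, PowerSeries.coeff_map,
      PowerSeries.coeff_zero_eq_constantCoeff_apply, hf.constantCoeff_eq, map_zero]
  coeff_one_eq := by rw [PowerSeries.coeff_map, hf.coeff_one_eq, map_one]
  subst_law := by
    have h := congrArg (MvPowerSeries.map (mapRat (φ : R →+* S))) hf.subst_law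
    have hF := PowerSeries.HasSubst.of_constantCoeff_zero
      (constantCoeff_map_eq_zero (toRat R) F.law.zero_constantCoeff)
    rw [map_add, PowerSeries.map_subst hF, PowerSeries.map_subst (PowerSeries.HasSubst.X 0),
      PowerSeries.map_subst (PowerSeries.HasSubst.X 1), MvPowerSeries.map_X,
      MvPowerSeries.map_X] at h
    refine Eq.trans (congrArg (fun z => PowerSeries.subst z _) ?_) h
    ext d
    simp only [FormalModule.map, FormalGroup.map_toPowerSeries, MvPowerSeries.coeff_map]
    exact (mapRat_toRat _ _).symm

end IsLogarithm

end FormalModule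

/-! ### The universal typical formal module -/

/-- `ϖ` generates the maximal ideal of the local ring `A`, whose residue field has `q = p ^ r`
elements. -/
structure IsUniformizer {A : Type*} [CommRing A] [IsLocalRing A] (p r : ℕ) (ϖ : A) : Prop where
  prime : p.Prime
  r_ne_zero : r ≠ 0
  residueCard_eq : residueCard A = p ^ r
  maximalIdeal_eq : IsLocalRing.maximalIdeal A = Ideal.span {ϖ}

namespace IsUniformizer

variable {A : Type*} [CommRing A] [IsLocalRing A] {p r : ℕ} {ϖ : A} (h : IsUniformizer p r ϖ)
include h

theorem one_lt_residueCard : 1 < residueCard A := by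
  rw [h.residueCard_eq]
  exact Nat.one_lt_pow h.r_ne_zero h.prime.one_lt

theorem dvd_iff_residue_eq_zero {a : A} : ϖ ∣ a ↔ IsLocalRing.residue A a = 0 := by
  rw [IsLocalRing.residue_eq_zero_iff, h.maximalIdeal_eq, Ideal.mem_span_singleton]

theorem finite_residueField : Finite (IsLocalRing.ResidueField A) :=
  Nat.finite_of_card_ne_zero (by have := h.one_lt_residueCard; rw [residueCard] at this; omega)

theorem dvd_natCast : ϖ ∣ (p : A) := by
  have := h.finite_residueField
  have := Fintype.ofFinite (IsLocalRing.ResidueField A)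
  rw [h.dvd_iff_residue_eq_zero, map_natCast]
  have h1 := Nat.cast_card_eq_zero (IsLocalRing.ResidueField A)
  rw [← Nat.card_eq_fintype_card] at h1
  have h2 : Nat.card (IsLocalRing.ResidueField A) = p ^ r := h.residueCard_eq
  rw [h2, Nat.cast_pow] at h1
  exact pow_eq_zero_iff h.r_ne_zero |>.1 h1

theorem dvd_sub_pow (a : A) : ϖ ∣ a - a ^ p ^ r := by
  have := h.finite_residueField
  have := Fintype.ofFinite (IsLocalRing.ResidueField A)
  have h2 : Nat.card (IsLocalRing.ResidueField A) = p ^ r := h.residueCard_eq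
  rw [h.dvd_iff_residue_eq_zero, map_sub, map_pow, ← h2, Nat.card_eq_fintype_card,
    FiniteField.pow_card, sub_self]

theorem isUnit_one_sub_pow {n : ℕ} (hn : n ≠ 0) : IsUnit (1 - ϖ ^ n) := by
  rw [← IsLocalRing.notMem_maximalIdeal, h.maximalIdeal_eq, Ideal.mem_span_singleton]
  intro hd
  have h1 : ϖ ∣ 1 := (dvd_sub_left (dvd_pow_self ϖ hn)).1 hd
  refine (IsLocalRing.maximalIdeal.isMaximal A).ne_top ?_
  rw [h.maximalIdeal_eq, Ideal.span_singleton_eq_top]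
  exact isUnit_of_dvd_one h1

end IsUniformizer

namespace FormalModule

variable {A : Type u} [CommRing A] [IsLocalRing A] {p r : ℕ} {ϖ : A}

/-! ### The Hazewinkel relations and the series `[ϖ]`. -/

section HazewinkelRelation

variable {S : Type u} [CommRing S] [Algebra A S]

/-- `ϖ` divides `p`, which is invertible in `ℚ ⊗ S`. -/
theorem _root_.IsUniformizer.exists_toRat_mul_eq_one (h : IsUniformizer p r ϖ) (S : Type*)
    [CommRing S] [Algebra A S] : ∃ y, toRat S (algebraMap A S ϖ) * y = 1 := by
  obtain ⟨c, hc⟩ := h.dvd_natCast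
  refine ⟨(p : ℚ)⁻¹ ⊗ₜ algebraMap A S c, ?_⟩
  have h1 : toRat S (algebraMap A S ϖ) = (1 : ℚ) ⊗ₜ[ℤ] algebraMap A S ϖ := rfl
  rw [h1, Algebra.TensorProduct.tmul_mul_tmul, one_mul, ← map_mul, ← hc, map_natCast]
  have h2 : ((p : ℕ) : S) = (p : ℤ) • (1 : S) := by simp
  rw [h2, ← TensorProduct.smul_tmul, Algebra.TensorProduct.one_def]
  congr 1
  simp [h.prime.ne_zero]

theorem _root_.IsUniformizer.toRat_mul_cancel (h : IsUniformizer p r ϖ) {x y : ℚ ⊗[ℤ] S}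
    (hxy : toRat S (algebraMap A S ϖ) * x = toRat S (algebraMap A S ϖ) * y) : x = y := by
  obtain ⟨z, hz⟩ := h.exists_toRat_mul_eq_one S
  linear_combination z * hxy + (y - x) * hz

/-- The relation `ϖ ℓ_n = ∑_{i < n} ℓ_i v_{n-i} ^ (q ^ i)` in degree `n`. -/
def HazewinkelRelation (ϖ : A) (ℓ : ℕ → ℚ ⊗[ℤ] S) (v : ℕ → S) (n : ℕ) : Prop :=
  toRat S (algebraMap A S ϖ) * ℓ n =
    ∑ i ∈ Finset.range n, ℓ i * toRat S (v (n - i)) ^ residueCard A ^ i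

/-- The term `i = 0` is the only one containing `v (n + 1)`, and does so linearly with coefficient
`ℓ 0 = 1`; this makes the relations solvable for the generators. -/
theorem hazewinkelRelation_succ {ℓ : ℕ → ℚ ⊗[ℤ] S} (h0 : ℓ 0 = 1) {v : ℕ → S} {n : ℕ} :
    HazewinkelRelation ϖ ℓ v (n + 1) ↔ toRat S (algebraMap A S ϖ) * ℓ (n + 1) =
      ∑ i ∈ Finset.range n, ℓ (i + 1) * toRat S (v (n - i)) ^ residueCard A ^ (i + 1) +
        toRat S (v (n + 1)) := by
  rw [HazewinkelRelation, Finset.sum_range_succ']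
  simp only [Nat.add_sub_add_right, h0, Nat.sub_zero, pow_zero, pow_one, one_mul]

theorem HazewinkelRelation.log_unique (h : IsUniformizer p r ϖ) {ℓ ℓ' : ℕ → ℚ ⊗[ℤ] S}
    {v v' : ℕ → S} (h0 : ℓ 0 = ℓ' 0) {n : ℕ}
    (hℓ : ∀ k, 1 ≤ k → k ≤ n → HazewinkelRelation ϖ ℓ v k)
    (hℓ' : ∀ k, 1 ≤ k → k ≤ n → HazewinkelRelation ϖ ℓ' v' k)
    (hv : ∀ k, 1 ≤ k → k ≤ n → v k = v' k) {k : ℕ} (hk : k ≤ n) : ℓ k = ℓ' k := by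
  induction k using Nat.strong_induction_on with
  | _ k ih =>
  rcases Nat.eq_zero_or_pos k with rfl | hk0
  · exact h0
  refine h.toRat_mul_cancel ?_
  rw [hℓ k hk0 hk, hℓ' k hk0 hk]
  refine Finset.sum_congr rfl fun i hi => ?_
  rw [Finset.mem_range] at hi
  rw [ih i hi (by omega), hv (k - i) (by omega) (by omega)]

theorem HazewinkelRelation.unique [Module.IsTorsionFree ℤ S] {ℓ : ℕ → ℚ ⊗[ℤ] S}
    {v v' : ℕ → S} (h0 : ℓ 0 = 1) {n : ℕ}
    (hv : ∀ k, 1 ≤ k → k ≤ n → HazewinkelRelation ϖ ℓ v k)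
    (hv' : ∀ k, 1 ≤ k → k ≤ n → HazewinkelRelation ϖ ℓ v' k)
    {k : ℕ} (hk1 : 1 ≤ k) (hk : k ≤ n) : v k = v' k := by
  induction k using Nat.strong_induction_on with
  | _ k ih =>
  obtain ⟨m, rfl⟩ : ∃ m, k = m + 1 := ⟨k - 1, by omega⟩
  refine toRat_injective S ?_
  have h1 := (hazewinkelRelation_succ h0).1 (hv _ hk1 hk)
  rw [(hazewinkelRelation_succ h0).1 (hv' _ hk1 hk), Finset.sum_congr rfl fun i hi => ?_] at h1
  · exact (add_left_cancel h1).symm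
  · rw [Finset.mem_range] at hi
    rw [ih (m - i) (by omega) (by omega) (by omega)]

theorem HazewinkelRelation.map {T : Type u} [CommRing T] [Algebra A T] {ℓ : ℕ → ℚ ⊗[ℤ] S}
    {v : ℕ → S} {n : ℕ} (h : HazewinkelRelation ϖ ℓ v n) (φ : S →ₐ[A] T) :
    HazewinkelRelation ϖ (fun k => mapRat (φ : S →+* T) (ℓ k)) (fun k => φ (v k)) n := by
  have := congrArg (mapRat (φ : S →+* T)) h
  rw [map_mul, map_sum, mapRat_toRat] at this
  simp only [map_mul, map_pow, mapRat_toRat] at this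
  simpa [HazewinkelRelation] using this

/-- Comparison of the series `[ϖ](X)` of two formal modules whose logarithms agree up to
degree `q ^ n`. -/
theorem exists_toRat_eq_of_logarithm (h : IsUniformizer p r ϖ) {G G' : FormalModule A S}
    {ℓ ℓ' : ℕ → ℚ ⊗[ℤ] S} (hG : G.IsLogarithm (typicalSeries (residueCard A) ℓ))
    (hG' : G'.IsLogarithm (typicalSeries (residueCard A) ℓ')) {n : ℕ}
    (hℓ : ∀ k ≤ n, ℓ k = ℓ' k) :
    toRat S (PowerSeries.coeff (residueCard A ^ (n + 1)) (G.act ϖ) -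
      PowerSeries.coeff (residueCard A ^ (n + 1)) (G'.act ϖ)) =
    toRat S (algebraMap A S (1 - ϖ ^ (residueCard A ^ (n + 1) - 1))) *
      (toRat S (algebraMap A S ϖ) * ℓ (n + 1) - toRat S (algebraMap A S ϖ) * ℓ' (n + 1)) := by
  have hq := h.one_lt_residueCard
  have h1 := PowerSeries.coeff_sub_coeff_of_subst_eq_mul (x := PowerSeries.map (toRat S) (G.act ϖ))
    (x' := PowerSeries.map (toRat S) (G'.act ϖ)) hG.constantCoeff_eq hG.coeff_one_eq
    (constantCoeff_map_eq_zero (toRat S) (G.act_constantCoeff ϖ))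
    (constantCoeff_map_eq_zero (toRat S) (G'.act_constantCoeff ϖ))
    (by rw [PowerSeries.coeff_map, G'.act_coeff_one]) (hG.subst_act ϖ) (hG'.subst_act ϖ)
    (N := residueCard A ^ (n + 1)) (fun m hm => by
      by_cases hmk : ∃ k, m = residueCard A ^ k
      · obtain ⟨k, rfl⟩ := hmk
        rw [coeff_typicalSeries_pow _ hq, coeff_typicalSeries_pow _ hq]
        exact hℓ k (Nat.lt_succ_iff.1 ((Nat.pow_lt_pow_iff_right hq).1 hm))
      · push Not at hmk
        rw [coeff_typicalSeries_of_ne _ hmk, coeff_typicalSeries_of_ne _ hmk])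
  rw [PowerSeries.coeff_map, PowerSeries.coeff_map, ← map_sub, coeff_typicalSeries_pow _ hq,
    coeff_typicalSeries_pow _ hq] at h1
  rw [h1]
  -- The comparison produces the factor `ϖ - ϖ ^ (q ^ (n + 1))`; splitting off `ϖ` leaves the image
  -- of a unit of `A`.
  obtain ⟨N, hN⟩ : ∃ N, residueCard A ^ (n + 1) = N + 1 :=
    ⟨residueCard A ^ (n + 1) - 1, by have := pow_pos (by omega : 0 < residueCard A) (n + 1); omega⟩
  rw [hN, Nat.add_sub_cancel, map_sub, map_one, map_sub, map_one, map_pow, map_pow, pow_succ]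
  ring

end HazewinkelRelation

/-! ### The universal module over the polynomial ring. -/

section Universal

/-- The Hazewinkel generators `ϖ, X_0, X_1, …` of `A[X_0, X_1, …]`. -/
def polynomialGenerators (ϖ : A) : ℕ → MvPolynomial ℕ A
  | 0 => MvPolynomial.C ϖ
  | n + 1 => MvPolynomial.X n

/-- The `q`-th power map of the variables is a lift of Frobenius on `A[X_0, X_1, …]`. -/
def _root_.IsUniformizer.frobeniusLift [IsDomain A] [CharZero A] (h : IsUniformizer p r ϖ) :
    FrobeniusLift p r (MvPolynomial ℕ A) (ℚ ⊗[ℤ] MvPolynomial ℕ A) where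
  ι := toRat (MvPolynomial ℕ A)
  ϖ := MvPolynomial.C ϖ
  invϖ := (h.exists_toRat_mul_eq_one (MvPolynomial ℕ A)).choose
  σ := (MvPolynomial.expand (p ^ r)).toRingHom
  σP := mapRat (MvPolynomial.expand (p ^ r)).toRingHom
  prime := h.prime
  r_ne_zero := h.r_ne_zero
  ι_injective := toRat_injective _
  ι_mul_invϖ := (h.exists_toRat_mul_eq_one (MvPolynomial ℕ A)).choose_spec
  σP_ι x := mapRat_toRat _ x
  σ_ϖ := MvPolynomial.expand_C _ _
  ϖ_dvd_p := by
    rw [← map_natCast MvPolynomial.C]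
    exact map_dvd _ h.dvd_natCast
  ϖ_dvd_σ_sub_pow x := by
    change _ ∣ MvPolynomial.expand (p ^ r) x - _
    induction x using MvPolynomial.induction_on with
    | C a =>
      rw [MvPolynomial.expand_C, ← map_pow, ← map_sub]
      exact map_dvd _ (h.dvd_sub_pow a)
    | add x y hx hy =>
      obtain ⟨z, hz⟩ := exists_add_pow_prime_pow_eq h.prime x y r
      have hp : MvPolynomial.C ϖ ∣ ((p : ℕ) : MvPolynomial ℕ A) := by
        rw [← map_natCast MvPolynomial.C]
        exact map_dvd _ h.dvd_natCast
      have := dvd_sub (dvd_add hx hy) (hp.mul_right (x * y * z))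
      rw [map_add, hz]
      convert this using 1
      ring
    | mul_X x i hx =>
      rw [map_mul, MvPolynomial.expand_X, mul_pow, ← sub_mul]
      exact hx.mul_right _

variable [IsDomain A] [CharZero A]

/-- The coefficients of the logarithm of the universal typical formal module. -/
def _root_.IsUniformizer.universalLogCoeff (h : IsUniformizer p r ϖ) :
    ℕ → ℚ ⊗[ℤ] MvPolynomial ℕ A :=
  h.frobeniusLift.logCoeff (polynomialGenerators ϖ)

/-- The functional equation lemma applies to `f(X) + f(Y)` and `a f(X)`: its hypothesis is stable
under sums and under multiplication by constants fixed by `σ`, and `σ` fixes `A`. -/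
theorem exists_universal_isLogarithm (h : IsUniformizer p r ϖ) :
    ∃ F : FormalModule A (MvPolynomial ℕ A),
      F.IsLogarithm (typicalSeries (residueCard A) h.universalLogCoeff) := by
  let D := h.frobeniusLift
  let f := D.log (polynomialGenerators ϖ)
  have hf : f = typicalSeries (residueCard A) h.universalLogCoeff := by
    rw [h.residueCard_eq]; rfl
  have hf0 : PowerSeries.constantCoeff f = 0 := D.constantCoeff_log _
  have hf1 : PowerSeries.coeff 1 f = 1 := D.coeff_one_log _
  have hX : ∀ {n : ℕ} (i : Fin n), MvPowerSeries.constantCoeff (PowerSeries.subst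
      (MvPowerSeries.X i : MvPowerSeries (Fin n) (ℚ ⊗[ℤ] MvPolynomial ℕ A)) f) = 0 := fun i =>
    PowerSeries.constantCoeff_subst_eq_zero (MvPowerSeries.constantCoeff_X i) f hf0
  obtain ⟨F, hF0, hF⟩ := D.exists_subst_log_eq (v := polynomialGenerators ϖ)
    (by rw [map_add, hX 0, hX (1 : Fin 2), add_zero])
    ((D.satisfiesFunctionalEquation_subst_X (0 : Fin 2)).add D
      (D.satisfiesFunctionalEquation_subst_X 1))
  have hact : ∀ a : A, ∃ w : PowerSeries (MvPolynomial ℕ A), PowerSeries.constantCoeff w = 0 ∧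
      (PowerSeries.subst (PowerSeries.map (toRat _) w) f : PowerSeries _) =
        PowerSeries.C (toRat _ (algebraMap A _ a)) * f := fun a => by
    have h1 := D.satisfiesFunctionalEquation_subst_X (v := polynomialGenerators ϖ) ()
    have h2 := h1.C_mul D (a := algebraMap A _ a) (MvPolynomial.expand_C _ _)
    have h3 : PowerSeries.subst (MvPowerSeries.X () : MvPowerSeries Unit _) f = f :=
      PowerSeries.X_subst f
    rw [h3] at h2
    refine D.exists_subst_log_eq (v := polynomialGenerators ϖ) ?_ h2
    rw [map_mul]
    exact mul_eq_zero_of_right _ hf0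
  choose act hact0 hact using hact
  refine ⟨ofLog (ι := toRat _) (toRat_injective _) hf0 hf1 hF0 hF hact0 hact, ?_⟩
  rw [← hf]
  exact ⟨hf0, hf1, hF⟩

theorem universalLogCoeff_zero (h : IsUniformizer p r ϖ) : h.universalLogCoeff 0 = 1 :=
  h.frobeniusLift.logCoeff_zero _

theorem hazewinkelRelation_universal (h : IsUniformizer p r ϖ) {n : ℕ} (hn : 1 ≤ n) :
    HazewinkelRelation ϖ h.universalLogCoeff (polynomialGenerators ϖ) n := by
  rw [HazewinkelRelation, h.residueCard_eq]
  exact h.frobeniusLift.ϖ_mul_logCoeff (polynomialGenerators ϖ)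
    (fun i => MvPolynomial.expand_X _ _) hn

variable {F : FormalModule A (MvPolynomial ℕ A)} {h : IsUniformizer p r ϖ}
  (hF : F.IsLogarithm (typicalSeries (residueCard A) h.universalLogCoeff))
include hF

theorem isLogarithm_map_universal {S : Type u} [CommRing S] [Algebra A S]
    (φ : MvPolynomial ℕ A →ₐ[A] S) : (F.map φ).IsLogarithm (typicalSeries (residueCard A)
      fun k => mapRat (φ : MvPolynomial ℕ A →+* S) (h.universalLogCoeff k)) := by
  rw [← map_typicalSeries]
  exact hF.map φ

/-- The relations have a solution over `ℚ ⊗ S`; the point is its integrality. Given generators up to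
`n`, the universal module specialized at them, with an arbitrary guess in index `n + 1`, has the
same logarithm up to degree `q ^ n`. Comparing the series `[ϖ]` then shows the error of the guess to
be integral. -/
theorem exists_hazewinkelRelation {S : Type u} [CommRing S] [Algebra A S] [Module.IsTorsionFree ℤ S]
    {G : FormalModule A S} {m : ℕ → ℚ ⊗[ℤ] S}
    (hG : G.IsLogarithm (typicalSeries (residueCard A) m)) (hm : m 0 = 1) :
    ∃ v : ℕ → S, ∀ n, 1 ≤ n → HazewinkelRelation ϖ m v n := by
  have hq := h.one_lt_residueCard
  have key : ∀ n, ∃ v : ℕ → S, ∀ k, 1 ≤ k → k ≤ n → HazewinkelRelation ϖ m v k := by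
    intro n
    induction n with
    | zero => exact ⟨0, fun k h1 h2 => by omega⟩
    | succ n ih =>
      obtain ⟨v, hv⟩ := ih
      let φ : MvPolynomial ℕ A →ₐ[A] S := MvPolynomial.aeval fun i => v (i + 1)
      have hφ : ∀ k, 1 ≤ k → φ (polynomialGenerators ϖ k) = v k := fun k hk => by
        obtain ⟨k, rfl⟩ : ∃ j, k = j + 1 := ⟨k - 1, by omega⟩
        simp [φ, polynomialGenerators]
      have h0 : mapRat (φ : MvPolynomial ℕ A →+* S) (h.universalLogCoeff 0) = 1 := by
        rw [universalLogCoeff_zero, map_one]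
      have hagree : ∀ k ≤ n,
          m k = mapRat (φ : MvPolynomial ℕ A →+* S) (h.universalLogCoeff k) := fun k hk =>
        HazewinkelRelation.log_unique h (hm.trans h0.symm) hv
          (fun k hk _ => (hazewinkelRelation_universal h hk).map φ)
          (fun k hk _ => (hφ k hk).symm) hk
      have h1 := exists_toRat_eq_of_logarithm h hG (isLogarithm_map_universal hF φ) hagree
      obtain ⟨y, hy⟩ := (h.isUnit_one_sub_pow
        (n := residueCard A ^ (n + 1) - 1)
        (by have := Nat.one_lt_pow (show n + 1 ≠ 0 by omega) hq; omega)).exists_right_inv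
      set x := PowerSeries.coeff (residueCard A ^ (n + 1)) (G.act ϖ) -
        PowerSeries.coeff (residueCard A ^ (n + 1)) ((F.map φ).act ϖ)
      have hy' := congrArg (fun z => toRat S (algebraMap A S z)) hy
      simp only [map_mul, map_one] at hy'
      -- As `y` inverts the unit in `h1`, the correction `y x` equals the difference of the two
      -- values of `ϖ ℓ_{n+1}`.
      refine ⟨Function.update v (n + 1) (v (n + 1) + algebraMap A S y * x), fun k hk1 hk => ?_⟩
      have hold : ∀ k, k ≤ n → Function.update v (n + 1) (v (n + 1) + algebraMap A S y * x) k =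
          v k := fun k hk => Function.update_of_ne (by omega) _ _
      rcases hk.lt_or_eq with hlt | rfl
      · have h2 := hv k hk1 (by omega)
        rw [HazewinkelRelation] at h2 ⊢
        rw [h2]
        exact Finset.sum_congr rfl fun i _ => by rw [hold _ (by omega)]
      · have h2 := (hazewinkelRelation_succ h0).1 ((hazewinkelRelation_universal h hk1).map φ)
        rw [hφ _ hk1] at h2
        rw [hazewinkelRelation_succ hm, Function.update_self, map_add, map_mul, h1, ← mul_assoc,
          mul_comm (toRat S (algebraMap A S y)), hy', one_mul, h2,
          Finset.sum_congr rfl fun i hi => ?_]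
        · ring
        · rw [Finset.mem_range] at hi
          rw [hold _ (by omega), hagree _ (by omega), hφ _ (by omega)]
  choose v hv using key
  -- The partial solutions agree wherever both are constrained, by uniqueness, so the diagonal
  -- solves all the relations.
  refine ⟨fun k => v k k, fun n hn => ?_⟩
  have h2 := hv n n hn le_rfl
  rw [HazewinkelRelation] at h2 ⊢
  rw [h2]
  refine Finset.sum_congr rfl fun i hi => ?_
  rw [Finset.mem_range] at hi
  rw [HazewinkelRelation.unique hm (n := n - i) (fun k h1 h2 => hv n k h1 (by omega)) (hv (n - i))
    (by omega) le_rfl]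

theorem exists_map_eq_of_hasTypicalLogarithm {S : Type u} [CommRing S] [Algebra A S]
    [Module.IsTorsionFree ℤ S] {G : FormalModule A S} (hG : G.HasTypicalLogarithm) :
    ∃ φ : MvPolynomial ℕ A →ₐ[A] S, F.map φ = G := by
  obtain ⟨g, hg, hgt⟩ := hG
  have hq := h.one_lt_residueCard
  have hgs := eq_typicalSeries hq hgt
  set m := fun k => PowerSeries.coeff (residueCard A ^ k) g
  rw [hgs] at hg
  have hm : m 0 = 1 := by rw [← hg.coeff_one_eq, coeff_one_typicalSeries _ hq]
  obtain ⟨v, hv⟩ := exists_hazewinkelRelation hF hg hm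
  let φ : MvPolynomial ℕ A →ₐ[A] S := MvPolynomial.aeval fun i => v (i + 1)
  refine ⟨φ, IsLogarithm.eq (isLogarithm_map_universal hF φ) ?_⟩
  convert hg using 2
  funext n
  refine HazewinkelRelation.log_unique h (n := n) ?_
    (fun k hk _ => (hazewinkelRelation_universal h hk).map φ) (fun k hk _ => hv k hk)
    (fun k hk _ => ?_) le_rfl
  · rw [universalLogCoeff_zero, map_one, hm]
  · obtain ⟨k, rfl⟩ : ∃ j, k = j + 1 := ⟨k - 1, by omega⟩
    simp [φ, polynomialGenerators]

/-- As `R` may have torsion, logarithms over `R` are of no use. The comparison of `[ϖ]` is made in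
the polynomial ring instead, between `F` and its pushforward along the truncation `θ`; it gives an
integral identity for a unit multiple of `X_n`, to which `φ` and `ψ` are applied. -/
theorem algHom_ext_of_map_eq {R : Type u} [CommRing R] [Algebra A R]
    {φ ψ : MvPolynomial ℕ A →ₐ[A] R} (hφψ : F.map φ = F.map ψ) : φ = ψ := by
  refine MvPolynomial.algHom_ext fun n => ?_
  induction n using Nat.strong_induction_on with
  | _ n ih =>
  -- Killing the variables from `X_n` on makes `φ ∘ θ = ψ ∘ θ` by induction, without changing the
  -- logarithm up to degree `q ^ n`.
  let θ : MvPolynomial ℕ A →ₐ[A] MvPolynomial ℕ A :=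
    MvPolynomial.aeval fun i => if i < n then MvPolynomial.X i else 0
  have hθ : φ.comp θ = ψ.comp θ := by
    refine MvPolynomial.algHom_ext fun i => ?_
    simp only [θ, AlgHom.comp_apply, MvPolynomial.aeval_X]
    split_ifs with hi
    · exact ih i hi
    · rw [map_zero, map_zero]
  have hθv : ∀ k, 1 ≤ k → k ≤ n → polynomialGenerators ϖ k = θ (polynomialGenerators ϖ k) :=
    fun k hk hkn => by
      obtain ⟨k, rfl⟩ : ∃ j, k = j + 1 := ⟨k - 1, by omega⟩
      simp only [θ, polynomialGenerators, MvPolynomial.aeval_X]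
      rw [if_pos (by omega)]
  have h0 : mapRat (θ : MvPolynomial ℕ A →+* MvPolynomial ℕ A) (h.universalLogCoeff 0) = 1 := by
    rw [universalLogCoeff_zero, map_one]
  have hagree : ∀ k ≤ n, h.universalLogCoeff k =
      mapRat (θ : MvPolynomial ℕ A →+* MvPolynomial ℕ A) (h.universalLogCoeff k) := fun k hk =>
    HazewinkelRelation.log_unique h ((universalLogCoeff_zero h).trans h0.symm)
      (fun k hk _ => hazewinkelRelation_universal h hk)
      (fun k hk _ => (hazewinkelRelation_universal h hk).map θ) hθv hk
  have h1 := exists_toRat_eq_of_logarithm h hF (isLogarithm_map_universal hF θ) hagree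
  have h2 := (hazewinkelRelation_succ (universalLogCoeff_zero h)).1
    (hazewinkelRelation_universal h n.succ_pos)
  have h3 := (hazewinkelRelation_succ h0).1 ((hazewinkelRelation_universal h n.succ_pos).map θ)
  have h4 : θ (polynomialGenerators ϖ (n + 1)) = 0 := by
    simp [θ, polynomialGenerators]
  have h9 : ∀ i ∈ Finset.range n,
      mapRat (θ : MvPolynomial ℕ A →+* MvPolynomial ℕ A) (h.universalLogCoeff (i + 1)) *
        toRat _ (θ (polynomialGenerators ϖ (n - i))) ^ residueCard A ^ (i + 1) =
      h.universalLogCoeff (i + 1) *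
        toRat _ (polynomialGenerators ϖ (n - i)) ^ residueCard A ^ (i + 1) := fun i hi => by
    rw [Finset.mem_range] at hi
    rw [← hagree _ (by omega), ← hθv _ (by omega) (by omega)]
  rw [h2, h3, h4, map_zero, add_zero, Finset.sum_congr rfl h9, add_sub_cancel_left,
    ← map_mul] at h1
  have h5 := toRat_injective _ h1
  have h6 : ∀ χ : MvPolynomial ℕ A →ₐ[A] R,
      algebraMap A R (1 - ϖ ^ (residueCard A ^ (n + 1) - 1)) * χ (MvPolynomial.X n) =
        PowerSeries.coeff (residueCard A ^ (n + 1)) ((F.map χ).act ϖ) -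
        (χ.comp θ) (PowerSeries.coeff (residueCard A ^ (n + 1)) (F.act ϖ)) := fun χ => by
    have h7 := congrArg χ h5
    rw [map_mul, AlgHom.commutes, map_sub] at h7
    refine h7.symm.trans (congrArg₂ _ ?_ (congrArg χ ?_))
    · simp [FormalModule.map]
    · simp [FormalModule.map]
  have h8 := h6 φ
  rw [hφψ, hθ, ← h6 ψ] at h8
  refine ((h.isUnit_one_sub_pow ?_).map (algebraMap A R)).mul_left_cancel h8
  have := Nat.one_lt_pow (show n + 1 ≠ 0 by omega) h.one_lt_residueCard
  omega

end Universal

section MapMap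

variable {A R S T : Type*} [CommRing A] [CommRing R] [CommRing S] [CommRing T] [Algebra A R]
  [Algebra A S] [Algebra A T]

theorem map_id (F : FormalModule A R) : F.map (AlgHom.id A R) = F := by
  refine FormalModule.ext (FormalGroup.ext ?_) (funext fun a => ?_)
  · ext d
    simp [FormalModule.map]
  · ext d
    simp [FormalModule.map]

theorem map_map (F : FormalModule A R) (φ : R →ₐ[A] S) (ψ : S →ₐ[A] T) :
    (F.map φ).map ψ = F.map (ψ.comp φ) := by
  refine FormalModule.ext (FormalGroup.ext ?_) (funext fun a => ?_)
  · ext d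
    simp [FormalModule.map]
  · ext d
    simp [FormalModule.map]

end MapMap

theorem IsTypical.of_hasTypicalLogarithm {S : Type u} [CommRing S] [Algebra A S]
    [Module.IsTorsionFree ℤ S] {G : FormalModule A S} (hG : G.HasTypicalLogarithm) :
    G.IsTypical :=
  ⟨S, inferInstance, inferInstance, G, AlgHom.id A S, inferInstance, hG, map_id G⟩

theorem isUniversalTypical_polynomial [IsDomain A] [CharZero A] {h : IsUniformizer p r ϖ}
    {F : FormalModule A (MvPolynomial ℕ A)}
    (hF : F.IsLogarithm (typicalSeries (residueCard A) h.universalLogCoeff)) :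
    F.IsUniversalTypical := by
  refine ⟨IsTypical.of_hasTypicalLogarithm ⟨_, hF, fun n hn => coeff_typicalSeries_of_ne _ hn⟩, ?_⟩
  rintro R _ _ G ⟨S, _, _, G', χ, _, hG', rfl⟩
  obtain ⟨φ, rfl⟩ := exists_map_eq_of_hasTypicalLogarithm hF hG'
  exact ⟨χ.comp φ, (map_map F φ χ).symm, fun ψ hψ =>
    algHom_ext_of_map_eq hF (hψ.trans (map_map F φ χ))⟩

end FormalModule

/-! ### Residue fields of `p`-adic number fields -/

section LocalDedekind

variable (R S : Type*) [CommRing R] [CommRing S] [IsLocalRing R] [IsLocalRing S]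
  [Algebra R S] [Module.Finite R S]

theorem liesOver_maximalIdeal_of_finite :
    (IsLocalRing.maximalIdeal S).LiesOver (IsLocalRing.maximalIdeal R) := by
  have : Algebra.IsIntegral R S := Algebra.IsIntegral.of_finite R S
  exact ⟨(IsLocalRing.eq_maximalIdeal
    (Ideal.isMaximal_comap_of_isIntegral_of_isMaximal (IsLocalRing.maximalIdeal S))).symm⟩

theorem residueCard_eq_pow_inertiaDeg :
    residueCard S = residueCard R ^ (IsLocalRing.maximalIdeal S).inertiaDeg R :=
  have := liesOver_maximalIdeal_of_finite R S
  (Ideal.cardQuot_pow_inertiaDeg (IsLocalRing.maximalIdeal R) (IsLocalRing.maximalIdeal S)).symm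

variable {R S} [IsDedekindDomain S] [Module.IsTorsionFree R S]
  (hram : (IsLocalRing.maximalIdeal S).ramificationIdx R = 1)
include hram

/-- Only one prime lies over the maximal ideal, so the fundamental identity `∑ e f = n` says that
the inertia degree is the rank. -/
theorem residueCard_eq_pow_finrank [IsDedekindDomain R]
    (hR : IsLocalRing.maximalIdeal R ≠ ⊥) :
    residueCard S = residueCard R ^ Module.finrank R S := by
  rw [residueCard_eq_pow_inertiaDeg R S]
  have e := IsLocalRing.primesOver_eq S hR
  have := Fintype.ofFinite ((IsLocalRing.maximalIdeal R).primesOver S)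
  have : Unique ((IsLocalRing.maximalIdeal R).primesOver S) := by
    rw [e]
    exact Set.uniqueSingleton _
  have hd : ((default : (IsLocalRing.maximalIdeal R).primesOver S) : Ideal S) =
      IsLocalRing.maximalIdeal S :=
    e.subset (default : (IsLocalRing.maximalIdeal R).primesOver S).2
  have h := Ideal.sum_ramification_inertia_eq_finrank (IsLocalRing.maximalIdeal R) S
  rw [Fintype.sum_unique, hd, hram, one_mul] at h
  rw [h]

/-- The maximal ideal of `S` divides `ϖ S`. A proper cofactor would be divisible by it again, and
its square would divide `ϖ S`, against ramification index one. -/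
theorem maximalIdeal_eq_span_algebraMap [IsDomain R] {ϖ : R}
    (hϖ : IsLocalRing.maximalIdeal R = Ideal.span {ϖ}) (h0 : ϖ ≠ 0) :
    IsLocalRing.maximalIdeal S = Ideal.span {algebraMap R S ϖ} := by
  have := liesOver_maximalIdeal_of_finite R S
  have hmap : (IsLocalRing.maximalIdeal R).map (algebraMap R S) =
      Ideal.span {algebraMap R S ϖ} := by
    rw [hϖ, Ideal.map_span, Set.image_singleton]
  have hbot : (IsLocalRing.maximalIdeal R).map (algebraMap R S) ≠ ⊥ := by
    rw [hmap, Ne, Ideal.span_singleton_eq_bot]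
    exact (map_ne_zero_iff _ (FaithfulSMul.algebraMap_injective R S)).2 h0
  rw [Ideal.IsDedekindDomain.ramificationIdx_eq_multiplicity (IsLocalRing.maximalIdeal R) _
    hbot] at hram
  have hle := Ideal.map_le_iff_le_comap.2
    ((IsLocalRing.maximalIdeal S).over_def (IsLocalRing.maximalIdeal R)).le
  obtain ⟨J, hJ⟩ := Ideal.dvd_iff_le.2 hle
  have hJ1 : J = ⊤ := by
    by_contra hJ'
    obtain ⟨I, hI⟩ := Ideal.dvd_iff_le.2 (IsLocalRing.le_maximalIdeal hJ')
    have hfin : FiniteMultiplicity (IsLocalRing.maximalIdeal S)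
        ((IsLocalRing.maximalIdeal R).map (algebraMap R S)) := by
      by_contra hinf
      have hprime : Prime (IsLocalRing.maximalIdeal S) :=
        Ideal.prime_of_isPrime (ne_bot_of_le_ne_bot hbot hle) inferInstance
      exact hinf (FiniteMultiplicity.of_prime_left hprime hbot)
    refine hfin.not_pow_dvd_of_multiplicity_lt (m := 2) (by omega) ⟨I, ?_⟩
    rw [hJ, hI, pow_two, mul_assoc]
  rw [hJ1, Ideal.mul_top] at hJ
  rw [← hJ, hmap]

end LocalDedekind

section PadicNumberField

variable (p : ℕ) [Fact p.Prime] (K L : Type*) [Field K] [Field L]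
  [Algebra ℚ_[p] K] [FiniteDimensional ℚ_[p] K] [Algebra ℚ_[p] L] [FiniteDimensional ℚ_[p] L]

instance padicRingOfIntegers_isDedekindDomain : IsDedekindDomain (padicRingOfIntegers p K) :=
  integralClosure.isDedekindDomain ℤ_[p] ℚ_[p] K

instance padicRingOfIntegers_finite : Module.Finite ℤ_[p] (padicRingOfIntegers p K) :=
  IsIntegralClosure.finite ℤ_[p] ℚ_[p] K (padicRingOfIntegers p K)

instance padicRingOfIntegers_isFractionRing : IsFractionRing (padicRingOfIntegers p K) K :=
  integralClosure.isFractionRing_of_finite_extension ℚ_[p] K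

instance padicRingOfIntegers_charZero : CharZero (padicRingOfIntegers p K) := by
  have : CharZero K := charZero_of_injective_algebraMap (algebraMap ℚ_[p] K).injective
  exact ⟨fun m n h => Nat.cast_injective (R := K) (by simpa using congrArg Subtype.val h)⟩

instance padicRingOfIntegers_isScalarTower [Algebra K L] [IsScalarTower ℚ_[p] K L] :
    IsScalarTower ℤ_[p] (padicRingOfIntegers p K) (padicRingOfIntegers p L) :=
  IsScalarTower.of_algebraMap_eq fun x => Subtype.ext
    (IsScalarTower.algebraMap_apply ℤ_[p] K L x)

theorem exists_residueCard_padicRingOfIntegers :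
    ∃ r, r ≠ 0 ∧ residueCard (padicRingOfIntegers p K) = p ^ r := by
  refine ⟨(IsLocalRing.maximalIdeal (padicRingOfIntegers p K)).inertiaDeg ℤ_[p],
    (Ideal.inertiaDeg_pos _ _).ne', ?_⟩
  rw [residueCard_eq_pow_inertiaDeg ℤ_[p] (padicRingOfIntegers p K)]
  congr 1
  rw [residueCard, Nat.card_congr PadicInt.residueField.toEquiv, Nat.card_zmod]

/-- A Dedekind domain with finitely many primes is principal, so the local ring of integers is a
discrete valuation ring. -/
theorem isUniformizer_of_irreducible {ϖ : padicRingOfIntegers p K} (hϖ : Irreducible ϖ) :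
    ∃ r, IsUniformizer p r ϖ := by
  obtain ⟨r, hr, hcard⟩ := exists_residueCard_padicRingOfIntegers p K
  refine ⟨r, Fact.out, hr, hcard, ?_⟩
  have hbot : IsLocalRing.maximalIdeal (padicRingOfIntegers p K) ≠ ⊥ := fun h => hϖ.ne_zero <| by
    have := (IsLocalRing.mem_maximalIdeal ϖ).2 hϖ.not_isUnit
    rwa [h, Ideal.mem_bot] at this
  have : IsPrincipalIdealRing (padicRingOfIntegers p K) := by
    refine IsPrincipalIdealRing.of_finite_primes (Set.Finite.subset
      (Set.toFinite {⊥, IsLocalRing.maximalIdeal (padicRingOfIntegers p K)}) fun I hI => ?_)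
    by_cases h : I = ⊥
    · exact Or.inl h
    · exact Or.inr (IsLocalRing.eq_maximalIdeal (Ring.DimensionLEOne.maximalOfPrime h hI))
  have : IsDiscreteValuationRing (padicRingOfIntegers p K) := { not_a_field' := hbot }
  exact hϖ.maximalIdeal_eq

variable [Algebra K L] [IsScalarTower ℚ_[p] K L]

instance padicRingOfIntegers_finite' :
    Module.Finite (padicRingOfIntegers p K) (padicRingOfIntegers p L) :=
  Module.Finite.of_restrictScalars_finite ℤ_[p] _ _

instance padicRingOfIntegers_isTorsionFree :
    Module.IsTorsionFree (padicRingOfIntegers p K) (padicRingOfIntegers p L) := by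
  rw [Module.isTorsionFree_iff_algebraMap_injective]
  exact fun _ _ h => Subtype.ext ((algebraMap K L).injective (congrArg Subtype.val h))

theorem finrank_padicRingOfIntegers :
    Module.finrank (padicRingOfIntegers p K) (padicRingOfIntegers p L) = Module.finrank K L := by
  have : IsScalarTower (padicRingOfIntegers p K) (padicRingOfIntegers p L) L :=
    IsScalarTower.of_algebraMap_eq fun _ => rfl
  exact (IsFractionRing.finrank_eq (padicRingOfIntegers p K) K (padicRingOfIntegers p L) L).symm

variable (hunr : (IsLocalRing.maximalIdeal (padicRingOfIntegers p L)).ramificationIdx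
  (padicRingOfIntegers p K) = 1)
include hunr

theorem residueCard_padicRingOfIntegers_eq_pow {ϖ : padicRingOfIntegers p K}
    (hϖ : Irreducible ϖ) : residueCard (padicRingOfIntegers p L) =
      residueCard (padicRingOfIntegers p K) ^ Module.finrank K L := by
  rw [← finrank_padicRingOfIntegers p K L]
  refine residueCard_eq_pow_finrank hunr fun h => hϖ.ne_zero ?_
  have := (IsLocalRing.mem_maximalIdeal ϖ).2 hϖ.not_isUnit
  rwa [h, Ideal.mem_bot] at this

theorem isUniformizer_algebraMap {ϖ : padicRingOfIntegers p K} (hϖ : Irreducible ϖ) :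
    ∃ r, IsUniformizer p r (algebraMap (padicRingOfIntegers p K) (padicRingOfIntegers p L) ϖ) := by
  obtain ⟨_, h⟩ := isUniformizer_of_irreducible p K hϖ
  obtain ⟨r, hr, hcard⟩ := exists_residueCard_padicRingOfIntegers p L
  exact ⟨r, Fact.out, hr, hcard,
    maximalIdeal_eq_span_algebraMap hunr h.maximalIdeal_eq hϖ.ne_zero⟩

end PadicNumberField

/-! ### Presentations of the classifying rings -/

namespace FormalModule

section Presentation

variable {A : Type u} [CommRing A] [IsLocalRing A] {p r : ℕ} {ϖ : A}
  {V : Type u} [CommRing V] [Algebra A V] {F : FormalModule A V}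

/-- A presentation of `V` as a polynomial ring in the Hazewinkel generators of `F`. -/
structure HazewinkelPresentation (F : FormalModule A V) (ϖ : A) where
  equiv : MvPolynomial ℕ A ≃ₐ[A] V
  logCoeff : ℕ → ℚ ⊗[ℤ] V
  isTorsionFree : Module.IsTorsionFree ℤ V
  isLogarithm : F.IsLogarithm (typicalSeries (residueCard A) logCoeff)
  logCoeff_zero : logCoeff 0 = 1
  relation : ∀ n, 1 ≤ n →
    HazewinkelRelation ϖ logCoeff (fun k => equiv (polynomialGenerators ϖ k)) n

/-- Universal objects are unique up to isomorphism, so the structure of the polynomial model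
transfers to `V`. -/
theorem IsUniversalTypical.nonempty_hazewinkelPresentation [IsDomain A] [CharZero A]
    (h : IsUniformizer p r ϖ) (hF : F.IsUniversalTypical) :
    Nonempty (HazewinkelPresentation F ϖ) := by
  obtain ⟨F₀, hF₀⟩ := exists_universal_isLogarithm h
  have hU := isUniversalTypical_polynomial hF₀
  obtain ⟨φ, hφ, -⟩ := hU.2 V F hF.1
  obtain ⟨ψ, hψ, -⟩ := hF.2 _ F₀ hU.1
  have h1 : φ.comp ψ = AlgHom.id A V := (hF.2 V F hF.1).unique
    (by rw [← map_map, hψ, hφ]) (map_id F)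
  have h2 : ψ.comp φ = AlgHom.id A _ := (hU.2 _ F₀ hU.1).unique
    (by rw [← map_map, hφ, hψ]) (map_id F₀)
  let e := AlgEquiv.ofAlgHom φ ψ h1 h2
  have ht : Module.IsTorsionFree ℤ V :=
    e.symm.injective.moduleIsTorsionFree (e.symm : V → MvPolynomial ℕ A)
      fun n x => map_zsmul e.symm n x
  refine ⟨e, fun k => mapRat (φ : MvPolynomial ℕ A →+* V) (h.universalLogCoeff k), ht, ?_, ?_, ?_⟩
  · rw [← hφ]
    exact isLogarithm_map_universal hF₀ φ
  · rw [universalLogCoeff_zero, map_one]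
  · exact fun n hn => (hazewinkelRelation_universal h hn).map φ

namespace HazewinkelPresentation

variable (H : HazewinkelPresentation F ϖ) (h : IsUniformizer p r ϖ)

/-- The Hazewinkel generators. -/
def gen (k : ℕ) : V := H.equiv (polynomialGenerators ϖ k)

theorem gen_zero : H.gen 0 = algebraMap A V ϖ := H.equiv.commutes ϖ

theorem gen_succ (k : ℕ) : H.gen (k + 1) = H.equiv (MvPolynomial.X k) := rfl

include h in
theorem isHazewinkelSequence_iff {v : ℕ → V} : F.IsHazewinkelSequence ϖ v ↔ v = H.gen := by
  have := H.isTorsionFree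
  have hq := h.one_lt_residueCard
  have hrel : ∀ (v : ℕ → V) (n : ℕ), HazewinkelRelation ϖ H.logCoeff v n ↔
      ((1 : ℚ) ⊗ₜ[ℤ] algebraMap A V ϖ) * PowerSeries.coeff (residueCard A ^ n)
        (typicalSeries (residueCard A) H.logCoeff) =
      ∑ i ∈ Finset.range n, PowerSeries.coeff (residueCard A ^ i)
        (typicalSeries (residueCard A) H.logCoeff) *
          ((1 : ℚ) ⊗ₜ[ℤ] v (n - i)) ^ (residueCard A ^ i) := fun v n => by
    simp only [coeff_typicalSeries_pow _ hq]
    rfl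
  constructor
  · rintro ⟨h0, f, hf, hv⟩
    rw [hf.unique H.isLogarithm] at hv
    funext k
    rcases Nat.eq_zero_or_pos k with rfl | hk
    · rw [h0, H.gen_zero]
    · exact HazewinkelRelation.unique H.logCoeff_zero (n := k)
        (fun j h1 _ => (hrel v j).2 (hv j h1)) (fun j h1 _ => H.relation j h1) hk le_rfl
  · rintro rfl
    exact ⟨H.gen_zero, _, H.isLogarithm, fun n hn => (hrel H.gen n).1 (H.relation n hn)⟩

include H h in
theorem existsUnique_isHazewinkelSequence : ∃! v : ℕ → V, F.IsHazewinkelSequence ϖ v :=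
  ⟨H.gen, (H.isHazewinkelSequence_iff h).2 rfl, fun _ hv => (H.isHazewinkelSequence_iff h).1 hv⟩

theorem ringHom_ext {T : Type*} [CommRing T] {φ ψ : V →+* T}
    (h0 : ∀ a, φ (algebraMap A V a) = ψ (algebraMap A V a))
    (h1 : ∀ k, φ (H.gen (k + 1)) = ψ (H.gen (k + 1))) : φ = ψ := by
  have h2 : φ.comp (H.equiv : MvPolynomial ℕ A →+* V) =
      ψ.comp (H.equiv : MvPolynomial ℕ A →+* V) := by
    refine MvPolynomial.ringHom_ext (fun a => ?_) h1
    have h3 : H.equiv (MvPolynomial.C a) = algebraMap A V a := H.equiv.commutes a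
    simpa [h3] using h0 a
  ext x
  simpa using DFunLike.congr_fun h2 (H.equiv.symm x)

end HazewinkelPresentation

theorem exists_isUniversalTypical {A : Type u} [CommRing A] [IsLocalRing A] [IsDomain A]
    [CharZero A] {p r : ℕ} {ϖ : A} (h : IsUniformizer p r ϖ) :
    ∃ (V : Type u) (_ : CommRing V) (_ : Algebra A V) (F : FormalModule A V),
      F.IsUniversalTypical := by
  obtain ⟨F, hF⟩ := exists_universal_isLogarithm h
  exact ⟨MvPolynomial ℕ A, inferInstance, inferInstance, F, isUniversalTypical_polynomial hF⟩

end Presentation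

/-! ### The classifying map of an unramified extension -/

section Unramified

variable {A B : Type u} [CommRing A] [IsLocalRing A] [CommRing B] [IsLocalRing B] [Algebra A B]
  {p r s f : ℕ} {ϖ : A} {VA VB : Type u} [CommRing VA] [CommRing VB] [Algebra A VA] [Algebra B VB]
  [Algebra A VB] [IsScalarTower A B VB] {FA : FormalModule A VA} {FB : FormalModule B VB}

omit [IsLocalRing A] [IsLocalRing B] in
theorem IsLogarithm.restrictScalars {g : PowerSeries (ℚ ⊗[ℤ] VB)} (hg : FB.IsLogarithm g) :
    (FB.restrictScalars A).IsLogarithm g :=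
  ⟨hg.constantCoeff_eq, hg.coeff_one_eq, hg.subst_law⟩

theorem typicalSeries_pow {P : Type*} [CommRing P] {q : ℕ} (hq : 1 < q) (hf : f ≠ 0) (ℓ : ℕ → P) :
    typicalSeries (q ^ f) ℓ = typicalSeries q fun n => if f ∣ n then ℓ (n / f) else 0 := by
  have hqf : 1 < q ^ f := Nat.one_lt_pow hf hq
  ext m
  by_cases hm : ∃ k, m = q ^ k
  · obtain ⟨k, rfl⟩ := hm
    rw [coeff_typicalSeries_pow _ hq]
    split_ifs with hd
    · obtain ⟨j, rfl⟩ := hd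
      rw [pow_mul, coeff_typicalSeries_pow _ hqf, Nat.mul_div_cancel_left _ (by omega)]
    · refine coeff_typicalSeries_of_ne _ fun j hj => hd ⟨j, ?_⟩
      rw [← pow_mul] at hj
      exact Nat.pow_right_injective hq hj
  · push Not at hm
    rw [coeff_typicalSeries_of_ne _ hm, coeff_typicalSeries_of_ne]
    exact fun k hk => hm (f * k) (by rw [hk, pow_mul])

variable (HA : HazewinkelPresentation FA ϖ) (HB : HazewinkelPresentation FB (algebraMap A B ϖ))
  (hA : IsUniformizer p r ϖ) (hB : IsUniformizer p s (algebraMap A B ϖ))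
  (hcard : residueCard B = residueCard A ^ f)

include hB hcard in
theorem residueDegree_ne_zero : f ≠ 0 := by
  rintro rfl
  have := hB.one_lt_residueCard
  rw [hcard, pow_zero] at this
  exact lt_irrefl _ this

include HB hA hB hcard

omit hA hB in
theorem isTypical_restrictScalars : (FB.restrictScalars A).IsTypical := by
  have := HB.isTorsionFree
  refine IsTypical.of_hasTypicalLogarithm ⟨_, HB.isLogarithm.restrictScalars, fun n hn => ?_⟩
  refine coeff_typicalSeries_of_ne _ fun k hk => hn (f * k) ?_
  rw [hk, hcard, pow_mul]

/-- If `f ∣ n`, the terms with `f ∣ i` survive, and `q_A ^ (f i) = q_B ^ i` turns them into the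
relation over `B`. If `f ∤ n`, then `f` cannot divide both `i` and `n - i`, and everything vanishes.
-/
theorem hazewinkelRelation_restrictScalars {n : ℕ} (hn : 1 ≤ n) :
    HazewinkelRelation ϖ (fun n => if f ∣ n then HB.logCoeff (n / f) else 0)
      (fun n => if f ∣ n then HB.gen (n / f) else 0) n := by
  have hf := residueDegree_ne_zero hB hcard
  have hq := hA.one_lt_residueCard
  rw [HazewinkelRelation]
  by_cases hd : f ∣ n
  · obtain ⟨m, rfl⟩ := hd
    have hm : 1 ≤ m := Nat.pos_of_ne_zero fun h => by simp [h] at hn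
    have h1 := HB.relation m hm
    rw [HazewinkelRelation] at h1
    rw [if_pos (dvd_mul_right f m), Nat.mul_div_cancel_left m (Nat.pos_of_ne_zero hf),
      IsScalarTower.algebraMap_apply A B VB, h1]
    refine Finset.sum_of_injOn (f * ·) (fun i _ j _ h => Nat.eq_of_mul_eq_mul_left
      (Nat.pos_of_ne_zero hf) h) (fun i hi => ?_) (fun i _ hi' => ?_) (fun i _ => ?_)
    · rw [Finset.mem_coe, Finset.mem_range] at hi ⊢
      exact Nat.mul_lt_mul_of_pos_left hi (Nat.pos_of_ne_zero hf)
    · rw [if_neg, zero_mul]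
      rintro ⟨j, rfl⟩
      refine hi' ⟨j, ?_, rfl⟩
      rw [Finset.mem_coe, Finset.mem_range]
      rename_i hi
      rw [Finset.mem_range] at hi
      exact Nat.lt_of_mul_lt_mul_left hi
    · rw [← Nat.mul_sub, if_pos (dvd_mul_right f i), if_pos (dvd_mul_right f _),
        Nat.mul_div_cancel_left _ (Nat.pos_of_ne_zero hf),
        Nat.mul_div_cancel_left _ (Nat.pos_of_ne_zero hf), hcard, pow_mul]
      rfl
  · rw [if_neg hd, mul_zero, eq_comm]
    refine Finset.sum_eq_zero fun i hi => ?_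
    by_cases hi' : f ∣ i
    · rw [Finset.mem_range] at hi
      rw [if_neg (c := f ∣ n - i), map_zero, zero_pow (pow_ne_zero i (by omega)), mul_zero]
      exact fun h => hd ((Nat.dvd_sub_iff_left hi.le hi').1 h)
    · rw [if_neg hi', zero_mul]

/-- The pushforward of `FA` and the restriction of `FB` share one logarithm. Both sequences solve
the Hazewinkel relations for it, and solutions in a torsion-free ring are unique. -/
theorem apply_gen_eq {γ : VA →ₐ[A] VB} (hγ : FA.map γ = FB.restrictScalars A) (i : ℕ) :
    γ (HA.gen i) = if f ∣ i then HB.gen (i / f) else 0 := by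
  have := HB.isTorsionFree
  have hf := residueDegree_ne_zero hB hcard
  have hq := hA.one_lt_residueCard
  rcases Nat.eq_zero_or_pos i with rfl | hi
  · rw [if_pos (dvd_zero f), Nat.zero_div, HA.gen_zero, HB.gen_zero, AlgHom.commutes,
      ← IsScalarTower.algebraMap_apply]
  have h1 := HA.isLogarithm.map γ
  have h2 := HB.isLogarithm.restrictScalars (A := A)
  rw [hγ, map_typicalSeries] at h1
  rw [hcard, typicalSeries_pow hq hf] at h2
  have h3 := h1.unique h2
  have h4 : (fun k => mapRat (γ : VA →+* VB) (HA.logCoeff k)) =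
      fun n => if f ∣ n then HB.logCoeff (n / f) else 0 := by
    funext k
    have := congrArg (PowerSeries.coeff (residueCard A ^ k)) h3
    rwa [coeff_typicalSeries_pow _ hq, coeff_typicalSeries_pow _ hq] at this
  refine HazewinkelRelation.unique (ϖ := ϖ) (v := fun i => γ (HA.gen i))
    (v' := fun i => if f ∣ i then HB.gen (i / f) else 0)
    (ℓ := fun k => mapRat (γ : VA →+* VB) (HA.logCoeff k)) ?_
    (fun k hk _ => (HA.relation k hk).map γ) (fun k hk _ => ?_) hi le_rfl
  · rw [HA.logCoeff_zero, map_one]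
  · rw [h4]
    exact hazewinkelRelation_restrictScalars HB hA hB hcard hk

omit hA hB hcard in
/-- The base change of the classifying map induces an isomorphism of the quotient by the generators
whose index is not divisible by `f`. -/
theorem exists_quotient_equiv (hf : f ≠ 0) {γ : VA →ₐ[A] VB}
    (hγ : ∀ i, γ (HA.gen i) = if f ∣ i then HB.gen (i / f) else 0) :
    ∃ e : ((VA ⊗[A] B) ⧸ Ideal.span {x : VA ⊗[A] B | ∃ i, ¬ f ∣ i ∧ x = HA.gen i ⊗ₜ[A] 1}) ≃+* VB,
      ∀ (x : VA) (b : B), e (Ideal.Quotient.mk _ (x ⊗ₜ[A] b)) = γ x * algebraMap B VB b := by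
  set I := Ideal.span {x : VA ⊗[A] B | ∃ i, ¬ f ∣ i ∧ x = HA.gen i ⊗ₜ[A] 1} with hI
  let Γ : VA ⊗[A] B →ₐ[A] VB :=
    Algebra.TensorProduct.lift γ (IsScalarTower.toAlgHom A B VB) fun _ _ => Commute.all _ _
  have hΓ : ∀ (x : VA) (b : B), Γ (x ⊗ₜ[A] b) = γ x * algebraMap B VB b := fun x b => by
    simp [Γ]
  have hker : ∀ x ∈ I, (Γ : VA ⊗[A] B →+* VB) x = 0 := by
    intro x hx
    suffices h : I ≤ RingHom.ker (Γ : VA ⊗[A] B →+* VB) from h hx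
    rw [hI, Ideal.span_le]
    rintro _ ⟨i, hi, rfl⟩
    rw [SetLike.mem_coe, RingHom.mem_ker, RingHom.coe_coe, hΓ, hγ, if_neg hi, zero_mul]
  let q : (VA ⊗[A] B) ⧸ I →+* VB := Ideal.Quotient.lift I (Γ : VA ⊗[A] B →+* VB) hker
  have hq : ∀ (x : VA) (b : B), q (Ideal.Quotient.mk I (x ⊗ₜ[A] b)) = γ x * algebraMap B VB b :=
    fun x b => (Ideal.Quotient.lift_mk I _ hker).trans (hΓ x b)
  let β : B →+* (VA ⊗[A] B) ⧸ I := (Ideal.Quotient.mk I).comp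
    (Algebra.TensorProduct.includeRight : B →ₐ[A] VA ⊗[A] B).toRingHom
  -- The inverse map is prescribed on polynomial generators; variable `j` is the generator of index
  -- `j + 1`, since index `0` is the constant `ϖ`.
  let ψ : VB →+* (VA ⊗[A] B) ⧸ I := (MvPolynomial.eval₂Hom β
    fun j => Ideal.Quotient.mk I (HA.gen (f * (j + 1)) ⊗ₜ[A] 1)).comp
      (HB.equiv.symm : VB →+* MvPolynomial ℕ B)
  have hψB : ∀ b, ψ (algebraMap B VB b) = Ideal.Quotient.mk I (1 ⊗ₜ[A] b) := fun b => by
    have h1 : HB.equiv.symm (algebraMap B VB b) = MvPolynomial.C b := HB.equiv.symm.commutes b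
    simp [ψ, h1, β]
  have hψX : ∀ j, ψ (HB.gen (j + 1)) = Ideal.Quotient.mk I (HA.gen (f * (j + 1)) ⊗ₜ[A] 1) :=
    fun j => by simp [ψ, HB.gen_succ]
  have h1 : q.comp ψ = RingHom.id VB := by
    refine HB.ringHom_ext (fun b => ?_) fun j => ?_
    · rw [RingHom.comp_apply, hψB, hq, map_one, one_mul, RingHom.id_apply]
    · rw [RingHom.comp_apply, hψX, hq, map_one, mul_one, hγ, if_pos (dvd_mul_right f _),
        Nat.mul_div_cancel_left _ (Nat.pos_of_ne_zero hf), RingHom.id_apply]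
  -- `ψ ∘ q` is tested on the two tensor factors separately. On the first, generators with index
  -- divisible by `f` are recovered, and the others are zero in the quotient.
  have hleft : (ψ.comp q).comp ((Ideal.Quotient.mk I).comp
      (Algebra.TensorProduct.includeLeft : VA →ₐ[A] VA ⊗[A] B).toRingHom) =
      (Ideal.Quotient.mk I).comp
        (Algebra.TensorProduct.includeLeft : VA →ₐ[A] VA ⊗[A] B).toRingHom := by
    refine HA.ringHom_ext (fun a => ?_) fun j => ?_
    · change ψ (q (Ideal.Quotient.mk I (algebraMap A VA a ⊗ₜ[A] (1 : B)))) =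
        Ideal.Quotient.mk I (algebraMap A VA a ⊗ₜ[A] (1 : B))
      rw [hq, map_one, mul_one, AlgHom.commutes, IsScalarTower.algebraMap_apply A B VB, hψB,
        Algebra.algebraMap_eq_smul_one, Algebra.algebraMap_eq_smul_one, TensorProduct.smul_tmul]
    · change ψ (q (Ideal.Quotient.mk I (HA.gen (j + 1) ⊗ₜ[A] (1 : B)))) =
        Ideal.Quotient.mk I (HA.gen (j + 1) ⊗ₜ[A] (1 : B))
      rw [hq, map_one, mul_one, hγ]
      split_ifs with hd
      · obtain ⟨m, hm⟩ := hd
        obtain ⟨k, rfl⟩ : ∃ k, m = k + 1 := Nat.exists_eq_succ_of_ne_zero fun h0 => by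
          rw [h0, mul_zero] at hm
          exact Nat.succ_ne_zero _ hm
        rw [hm, Nat.mul_div_cancel_left _ (Nat.pos_of_ne_zero hf), hψX]
      · rw [map_zero, eq_comm, Ideal.Quotient.eq_zero_iff_mem]
        exact Ideal.subset_span ⟨j + 1, hd, rfl⟩
  have h2 : ψ.comp q = RingHom.id _ := by
    refine Ideal.Quotient.ringHom_ext (RingHom.ext fun x => ?_)
    induction x using TensorProduct.induction_on with
    | zero => rw [map_zero, map_zero]
    | add x y hx hy => rw [map_add, map_add, hx, hy]
    | tmul x b =>
      have h3 : x ⊗ₜ[A] b = (x ⊗ₜ[A] 1) * ((1 : VA) ⊗ₜ[A] b) := by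
        rw [Algebra.TensorProduct.tmul_mul_tmul, mul_one, one_mul]
      have h4 : ψ (q (Ideal.Quotient.mk I (x ⊗ₜ[A] 1))) = Ideal.Quotient.mk I (x ⊗ₜ[A] 1) :=
        DFunLike.congr_fun hleft x
      have h5 : ψ (q (Ideal.Quotient.mk I (1 ⊗ₜ[A] b))) = Ideal.Quotient.mk I (1 ⊗ₜ[A] b) := by
        rw [hq, map_one, one_mul, hψB]
      rw [RingHom.comp_apply, RingHom.comp_apply, h3, map_mul, map_mul, map_mul, h4, h5]
      rfl
  exact ⟨RingEquiv.ofRingHom q ψ h1 h2, hq⟩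

omit HB hA hB hcard in
/-- The structure of the classifying map, for universal typical formal modules over `A` and `B`. -/
theorem IsUniversalTypical.classifyingMap [IsDomain A] [CharZero A] [IsDomain B] [CharZero B]
    (hA : IsUniformizer p r ϖ) (hB : IsUniformizer p s (algebraMap A B ϖ))
    (hcard : residueCard B = residueCard A ^ f)
    (hFA : FA.IsUniversalTypical) (hFB : FB.IsUniversalTypical) :
    (∃! vA : ℕ → VA, FA.IsHazewinkelSequence ϖ vA) ∧
    (∃! vB : ℕ → VB, FB.IsHazewinkelSequence (algebraMap A B ϖ) vB) ∧
    (∃! γ : VA →ₐ[A] VB, FA.map γ = FB.restrictScalars A) ∧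
    ∀ (vA : ℕ → VA) (vB : ℕ → VB) (γ : VA →ₐ[A] VB), FA.IsHazewinkelSequence ϖ vA →
      FB.IsHazewinkelSequence (algebraMap A B ϖ) vB → FA.map γ = FB.restrictScalars A →
      (∀ i, γ (vA i) = if f ∣ i then vB (i / f) else 0) ∧
      (∀ g : VA →ₐ[A] VB, (∀ i, g (vA i) = if f ∣ i then vB (i / f) else 0) → g = γ) ∧
      ∃ e : ((VA ⊗[A] B) ⧸
          Ideal.span {x : VA ⊗[A] B | ∃ i, ¬ f ∣ i ∧ x = vA i ⊗ₜ[A] 1}) ≃+* VB,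
        ∀ (x : VA) (b : B),
          e (Ideal.Quotient.mk _ (x ⊗ₜ[A] b)) = γ x * algebraMap B VB b := by
  obtain ⟨HA⟩ := hFA.nonempty_hazewinkelPresentation hA
  obtain ⟨HB⟩ := hFB.nonempty_hazewinkelPresentation hB
  refine ⟨HA.existsUnique_isHazewinkelSequence hA, HB.existsUnique_isHazewinkelSequence hB,
    hFA.2 _ _ (isTypical_restrictScalars HB hcard), ?_⟩
  intro vA vB γ hvA hvB hγ
  obtain rfl := (HA.isHazewinkelSequence_iff hA).1 hvA
  obtain rfl := (HB.isHazewinkelSequence_iff hB).1 hvB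
  have hval := apply_gen_eq HA HB hA hB hcard hγ
  refine ⟨hval, fun g hg => ?_, exists_quotient_equiv HA HB
    (residueDegree_ne_zero hB hcard) hval⟩
  have h1 : (g : VA →+* VB) = γ := HA.ringHom_ext (fun a => by simp) fun k => by
    simp only [RingHom.coe_coe, hg, hval]
  exact AlgHom.ext fun x => DFunLike.congr_fun h1 x

end Unramified

end FormalModule

end

theorem mainTheorem12 (p : ℕ) [Fact p.Prime] (K L : Type u) [Field K] [Field L]
    [Algebra ℚ_[p] K] [FiniteDimensional ℚ_[p] K]
    [Algebra ℚ_[p] L] [FiniteDimensional ℚ_[p] L]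
    [Algebra K L] [IsScalarTower ℚ_[p] K L]
    (f : ℕ) (hf : Module.finrank K L = f)
    (hunr : (IsLocalRing.maximalIdeal (padicRingOfIntegers p L)).ramificationIdx
      (padicRingOfIntegers p K) = 1)
    (ϖ : padicRingOfIntegers p K) (hϖ : Irreducible ϖ) :
    -- the classifying rings exist
    (∃ (V : Type u) (_ : CommRing V) (_ : Algebra (padicRingOfIntegers p K) V)
      (F : FormalModule (padicRingOfIntegers p K) V), F.IsUniversalTypical) ∧
    (∃ (V : Type u) (_ : CommRing V) (_ : Algebra (padicRingOfIntegers p L) V)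
      (F : FormalModule (padicRingOfIntegers p L) V), F.IsUniversalTypical) ∧
    ∀ (VA VB : Type u) [CommRing VA] [CommRing VB]
      [Algebra (padicRingOfIntegers p K) VA]
      [Algebra (padicRingOfIntegers p L) VB]
      [Algebra (padicRingOfIntegers p K) VB]
      [IsScalarTower (padicRingOfIntegers p K) (padicRingOfIntegers p L) VB]
      (FA : FormalModule (padicRingOfIntegers p K) VA)
      (FB : FormalModule (padicRingOfIntegers p L) VB),
      FA.IsUniversalTypical → FB.IsUniversalTypical →
      -- the Hazewinkel generators and the classifying map are well defined
      (∃! vA : ℕ → VA, FA.IsHazewinkelSequence ϖ vA) ∧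
      (∃! vB : ℕ → VB, FB.IsHazewinkelSequence
        (algebraMap (padicRingOfIntegers p K) (padicRingOfIntegers p L) ϖ) vB) ∧
      (∃! γ : VA →ₐ[padicRingOfIntegers p K] VB,
        FA.map γ = FB.restrictScalars (padicRingOfIntegers p K)) ∧
      ∀ (vA : ℕ → VA) (vB : ℕ → VB) (γ : VA →ₐ[padicRingOfIntegers p K] VB),
        FA.IsHazewinkelSequence ϖ vA →
        FB.IsHazewinkelSequence
          (algebraMap (padicRingOfIntegers p K) (padicRingOfIntegers p L) ϖ) vB →
        FA.map γ = FB.restrictScalars (padicRingOfIntegers p K) →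
        -- the values of the classifying map on the generators, which determine it
        (∀ i, γ (vA i) = if f ∣ i then vB (i / f) else 0) ∧
        (∀ g : VA →ₐ[padicRingOfIntegers p K] VB,
          (∀ i, g (vA i) = if f ∣ i then vB (i / f) else 0) → g = γ) ∧
        -- the base change of the classifying map induces the isomorphism
        ∃ e : ((VA ⊗[padicRingOfIntegers p K] padicRingOfIntegers p L) ⧸
            Ideal.span {x : VA ⊗[padicRingOfIntegers p K] padicRingOfIntegers p L |
              ∃ i, ¬ f ∣ i ∧ x = vA i ⊗ₜ[padicRingOfIntegers p K] 1}) ≃+* VB,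
          ∀ (x : VA) (b : padicRingOfIntegers p L),
            e (Ideal.Quotient.mk _ (x ⊗ₜ[padicRingOfIntegers p K] b)) =
              γ x * algebraMap (padicRingOfIntegers p L) VB b := by
  obtain ⟨r, hA⟩ := isUniformizer_of_irreducible p K hϖ
  obtain ⟨s, hB⟩ := isUniformizer_algebraMap p K L hunr hϖ
  have hcard := residueCard_padicRingOfIntegers_eq_pow p K L hunr hϖ
  rw [hf] at hcard
  refine ⟨FormalModule.exists_isUniversalTypical hA, FormalModule.exists_isUniversalTypical hB, ?_⟩
  intro VA VB _ _ _ _ _ _ FA FB hFA hFB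
  have h := FormalModule.IsUniversalTypical.classifyingMap hA hB hcard hFA hFB
  exact h
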